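/- **Setting.** A quantum system $H$ is a complex Hilbert space of arbitrary dimension; systems $A,B$ have a composite with space $A\otimes B$ (Hilbert space tensor product), and $\mathbb C$ is the trivial system. The canonical identifications $H\otimes\mathbb C\cong H\cong\mathbb C\otimes H$ and $(A\otimes B)\otimes C\cong A\otimes(B\otimes C)$ are free operations, in both directions. $\mathcal T(H)$ is the space of trace-class operators with norm $\|T\|_1=\operatorname{tr}|T|$. A quantum resource theory assigns * to every system $H$ a trace-norm compact set $\mathcal S(H)$ of density operators on $H$, such that $\rho\otimes\sigma\in\mathcal S(A\otimes B)$ for $\rho\in\mathcal S(A)$, $\sigma\in\mathcal S(B)$; * to every pair of systems a set $\mathcal O(H\to K)$ (the *free operations*) of completely positive trace-preserving linear maps $\mathcal T(H)\to\mathcal T(K)$ that map $\mathcal S(H)$ into $\mathcal S(K)$; it is compact in the bounded weak topology, i.e. the weakest topology making $\Phi\mapsto\operatorname{tr}[\Phi(T)M]$ continuous for all $T\in\mathcal T(H)$ and all bounded $M$ on $K$. Free operations are closed under composition and under tensor products, and $\mathrm{id}\in\mathcal O(H\to H)$ and $\operatorname{tr}\in\mathcal O(H\to\mathbb C)$ for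 every $H$. **Notions.** For $\phi,\psi\in\mathcal S(H)$ write $\phi\succeq\psi$ if $N(\phi)=\psi$ for some $N\in\mathcal O(H\to H)$. A state $\phi\in\mathcal S(H)$ is *maximally resourceful* if $\psi\succeq\phi$ implies $\phi\succeq\psi$ for every $\psi\in\mathcal S(H)$. A state $\psi\in\mathcal S(H)$ is *free*, $\psi\in\mathcal F(H)$, if for every system $H'$ and every $\phi\in\mathcal S(H')$ there is $N\in\mathcal O(H'\to H)$ with $N(\phi)=\psi$. For states $\phi$ of $H_1$ and $\psi$ of $H_2$, the asymptotic conversion rate $r_{\rm conv}(\phi\to\psi)\in[0,\infty]$ is the supremum of the $r\ge 0$ for which there are $N_n\in\mathcal O\big(H_1^{\otimes n}\to H_2^{\otimes\lceil rn\rceil}\big)$, $n\in\mathbb N$, with $$\liminf_{n\to\infty}\big\|N_n(\phi^{\otimes n})-\psi^{\otimes\lceil rn\rceil}\big\|_1=0,$$ where $H^{\otimes 0}=\mathbb C$ and $\phi^{\otimes 0}=1$. A state $\psi\in\mathcal S(H)$ is *catalytically replicable* if $\psi\notin\mathcal F(H)$ and $r_{\rm conv}(\psi\to\psi)=\infty$.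 Given normalization constants $R_{\max}^{(H)}\in[0,\infty)$, one for each system $H$, the *distillable resource* and the *resource cost* of $\psi\in\mathcal S(H)$ are $$R_{\rm D}(\psi)=\inf_{\phi\in\mathcal S(H)} r_{\rm conv}(\psi\to\phi)\,R_{\max}^{(H)},\qquad R_{\rm C}(\psi)=\inf_{\phi\in\mathcal S(H)}\frac{R_{\max}^{(H)}}{r_{\rm conv}(\phi\to\psi)},$$ as elements of $[0,\infty]$, with $\infty\cdot 0=0$, $c/\infty=0$, $c/0=\infty$ for $c>0$, and $0/0=0$. A *resource measure* is a family of functions $R_H:\mathcal S(H)\to\mathbb R$, one for each system $H$, with $R_K(N(\rho))\le R_H(\rho)$ for all $N\in\mathcal O(H\to K)$ and $\rho\in\mathcal S(H)$. It satisfies * *conventional normalization* if, for every $H$, $R_H(\sigma)=0$ for every free state $\sigma\in\mathcal F(H)$ and $R_H(\phi)=R_{\max}^{(H)}$ for every maximally resourceful $\phi\in\mathcal S(H)$; * *weak additivity* if $R_{H^{\otimes n}}(\rho^{\otimes n})=n\,R_H(\rho)$ for all $H$, $\rho\in\mathcal S(H)$ and $n\ge1$; * *strong superadditivity* if $R_{A\otimes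 B}(\rho)\ge R_A(\operatorname{tr}_B\rho)+R_B(\operatorname{tr}_A\rho)$ for all $A$, $B$ and $\rho\in\mathcal S(A\otimes B)$; * *lower semi-continuity* if every $R_H$ is lower semi-continuous on $\mathcal S(H)$ in trace norm. **Proposition.** Let $R$ be a resource measure that satisfies conventional normalization, weak additivity, strong superadditivity and lower semi-continuity. Let $H$ be a quantum system such that no state in $\mathcal S(H)$ is catalytically replicable. Then, for every $\psi\in\mathcal S(H)$, $$R_{\rm D}(\psi)\le R_H(\psi)\le R_{\rm C}(\psi).$$ -/

import Mathlib

set_option linter.unusedSectionVars false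
set_option linter.checkUnivs false

universe u v

open scoped NNReal ENNReal

noncomputable section

namespace QResource

open scoped InnerProductSpace ComplexOrder

/-! ### Trace, trace norm and trace-class operators -/

section TraceClass

variable {H : Type*} [NormedAddCommGroup H] [InnerProductSpace ℂ H] [CompleteSpace H]
variable {K : Type*} [NormedAddCommGroup K] [InnerProductSpace ℂ K] [CompleteSpace K]

variable (H) in
/-- An index set for the chosen orthonormal (Hilbert) basis of `H`. -/
def basisIndex : Set H := (exists_hilbertBasis ℂ H).choose

variable (H) in
/-- A chosen orthonormal (Hilbert) basis of `H`, used to evaluate traces. -/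
def stdBasis : HilbertBasis (basisIndex H) ℂ H := (exists_hilbertBasis ℂ H).choose_spec.choose

/-- The trace `tr T = ∑ ⟨k|T|k⟩`, the unordered sum over an orthonormal basis. It is meaningful
for trace-class operators, on which it does not depend on the basis. -/
def opTrace (T : H →L[ℂ] H) : ℂ := ∑' i, ⟪stdBasis H i, T (stdBasis H i)⟫_ℂ

/-- The trace norm `‖T‖₁ = tr |T|`, `|T| = √(T† T)`, of an arbitrary bounded operator,
with value `∞` allowed. -/
def eTraceNorm (T : H →L[ℂ] H) : ℝ≥0∞ :=
  ∑' i, ENNReal.ofReal (⟪stdBasis H i, CFC.abs T (stdBasis H i)⟫_ℂ).re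

theorem parseval {ι : Type*} (b : HilbertBasis ι ℂ H) (x : H) :
    ‖x‖ₑ ^ 2 = ∑' i, ‖⟪b i, x⟫_ℂ‖ₑ ^ 2 := by
  have h := b.hasSum_inner_mul_inner x x
  have h2 : HasSum (fun i => ‖⟪b i, x⟫_ℂ‖ ^ 2) (‖x‖ ^ 2) := by
    have := Complex.hasSum_re h
    simp only [inner_self_eq_norm_sq_to_K] at this
    convert this using 1
    · funext i
      rw [← inner_conj_symm x (b i), mul_comm, Complex.mul_conj, Complex.normSq_eq_norm_sq]
      exact (Complex.ofReal_re _).symm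
    · norm_cast
  have h3 : ∀ y : ℝ, 0 ≤ y → ENNReal.ofReal (y ^ 2) = ENNReal.ofReal y ^ 2 := fun y hy =>
    ENNReal.ofReal_pow hy 2
  have h4 := ENNReal.ofReal_tsum_of_nonneg (fun i => sq_nonneg ‖⟪b i, x⟫_ℂ‖) h2.summable
  rw [h2.tsum_eq, h3 _ (norm_nonneg _), ofReal_norm] at h4
  rw [h4]
  refine tsum_congr fun i => ?_
  rw [h3 _ (norm_nonneg _), ofReal_norm]

/-- The squared Hilbert-Schmidt norm in a basis equals that of the adjoint in any other basis. -/
theorem hs_adjoint {ι κ : Type*} (b : HilbertBasis ι ℂ H) (c : HilbertBasis κ ℂ K)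
    (T : H →L[ℂ] K) :
    ∑' i, ‖T (b i)‖ₑ ^ 2 = ∑' j, ‖ContinuousLinearMap.adjoint T (c j)‖ₑ ^ 2 := by
  simp_rw [parseval c, parseval b]
  rw [ENNReal.tsum_comm]
  refine tsum_congr fun j => tsum_congr fun i => ?_
  rw [ContinuousLinearMap.adjoint_inner_right, ← inner_conj_symm, RCLike.enorm_conj]

theorem hs_basis {ι κ : Type*} (b : HilbertBasis ι ℂ H) (c : HilbertBasis κ ℂ H)
    (T : H →L[ℂ] K) : ∑' i, ‖T (b i)‖ₑ ^ 2 = ∑' j, ‖T (c j)‖ₑ ^ 2 := by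
  rw [hs_adjoint b (stdBasis K), hs_adjoint c (stdBasis K)]

theorem hs_comp_le {ι : Type*} (b : HilbertBasis ι ℂ H) (T : H →L[ℂ] H) (A : H →L[ℂ] H)
    (hA : ‖A‖ ≤ 1) : ∑' i, ‖A (T (b i))‖ₑ ^ 2 ≤ ∑' i, ‖T (b i)‖ₑ ^ 2 := by
  refine ENNReal.tsum_le_tsum fun i => ?_
  gcongr
  have := A.le_of_opNorm_le hA (T (b i))
  rw [one_mul] at this
  exact enorm_le_iff_norm_le.mpr this

theorem hs_comp_le' {ι : Type*} (b : HilbertBasis ι ℂ H) (T : H →L[ℂ] H) (A : H →L[ℂ] H)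
    (hA : ‖A‖ ≤ 1) : ∑' i, ‖T (A (b i))‖ₑ ^ 2 ≤ ∑' i, ‖T (b i)‖ₑ ^ 2 := by
  have h := hs_adjoint b b (T ∘L A)
  simp only [ContinuousLinearMap.comp_apply] at h
  rw [h, hs_adjoint b b T]
  simp only [ContinuousLinearMap.adjoint_comp, ContinuousLinearMap.comp_apply]
  exact hs_comp_le b _ _ (by simpa using hA)

theorem inner_nonneg_op {P : H →L[ℂ] H} (hP : 0 ≤ P) (x : H) :
    ENNReal.ofReal (⟪x, P x⟫_ℂ).re = ‖CFC.sqrt P x‖ₑ ^ 2 := by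
  have h1 : P x = CFC.sqrt P (CFC.sqrt P x) := by
    conv_lhs => rw [← CFC.sqrt_mul_sqrt_self P hP]
    rfl
  have h2 : IsSelfAdjoint (CFC.sqrt P) := (CFC.sqrt_nonneg P).isSelfAdjoint
  have h3 : ⟪x, P x⟫_ℂ = ⟪CFC.sqrt P x, CFC.sqrt P x⟫_ℂ := by
    rw [h1, ← ContinuousLinearMap.adjoint_inner_left, h2.adjoint_eq]
  have h4 : (⟪CFC.sqrt P x, CFC.sqrt P x⟫_ℂ).re = ‖CFC.sqrt P x‖ ^ 2 :=
    inner_self_eq_norm_sq (𝕜 := ℂ) _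
  rw [h3, h4, ENNReal.ofReal_pow (norm_nonneg _), ofReal_norm]

/-- `tr |T| = ‖√|T|‖²` in Hilbert-Schmidt norm; in particular it is basis independent. -/
theorem eTraceNorm_eq {ι : Type*} (b : HilbertBasis ι ℂ H) (T : H →L[ℂ] H) :
    eTraceNorm T = ∑' i, ‖CFC.sqrt (CFC.abs T) (b i)‖ₑ ^ 2 := by
  rw [hs_basis b (stdBasis H)]
  exact tsum_congr fun i => inner_nonneg_op (CFC.abs_nonneg T) _

theorem norm_abs_apply (T : H →L[ℂ] H) (x : H) : ‖CFC.abs T x‖ = ‖T x‖ := by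
  have h2 : IsSelfAdjoint (CFC.abs T) := (CFC.abs_nonneg T).isSelfAdjoint
  have h1 : ⟪CFC.abs T x, CFC.abs T x⟫_ℂ = ⟪T x, T x⟫_ℂ := by
    have e1 : CFC.abs T (CFC.abs T x) = ContinuousLinearMap.adjoint T (T x) := by
      have := CFC.abs_mul_abs T
      exact congrArg (fun S : H →L[ℂ] H => S x) this
    rw [← ContinuousLinearMap.adjoint_inner_right (CFC.abs T), h2.adjoint_eq, e1,
      ContinuousLinearMap.adjoint_inner_right]
  rw [inner_self_eq_norm_sq_to_K, inner_self_eq_norm_sq_to_K] at h1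
  have h3 : ‖CFC.abs T x‖ ^ 2 = ‖T x‖ ^ 2 := by exact_mod_cast h1
  exact (pow_left_inj₀ (norm_nonneg _) (norm_nonneg _) two_ne_zero).mp h3

/-- Polar decomposition with a contraction. -/
theorem exists_polar (T : H →L[ℂ] H) : ∃ U : H →L[ℂ] H, ‖U‖ ≤ 1 ∧
    (∀ x, U (CFC.abs T x) = T x) ∧ ∀ x, ContinuousLinearMap.adjoint U (T x) = CFC.abs T x := by
  let p : Submodule ℂ H := (LinearMap.range (CFC.abs T).toLinearMap).topologicalClosure
  have hp : ∀ x, CFC.abs T x ∈ p := fun x =>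
    Submodule.le_topologicalClosure _ ⟨x, rfl⟩
  let e : H →ₗ[ℂ] p := (CFC.abs T).toLinearMap.codRestrict p hp
  have he : ∀ x, ‖e x‖ = ‖T x‖ := fun x => norm_abs_apply T x
  have hd : DenseRange e := by
    intro y
    have hy : (y : H) ∈ closure (Set.range fun x => CFC.abs T x) := y.2
    rw [Metric.mem_closure_iff] at hy ⊢
    intro ε hε
    obtain ⟨z, hz, hx⟩ := hy ε hε
    obtain ⟨x, rfl⟩ := hz
    exact ⟨e x, ⟨x, rfl⟩, hx⟩
  have hc : CompleteSpace p := (Submodule.isClosed_topologicalClosure _).completeSpace_coe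
  let U₀ : p →L[ℂ] H := T.toLinearMap.extendOfNorm e
  have hU₀ : ∀ x, U₀ (e x) = T x :=
    LinearMap.extendOfNorm_eq hd ⟨1, fun x => by rw [he]; simp⟩
  have hU₀n : ‖U₀‖ ≤ 1 :=
    LinearMap.opNorm_extendOfNorm_le hd zero_le_one (fun x => by rw [he]; simp)
  let U : H →L[ℂ] H := U₀ ∘L p.orthogonalProjectionOnto
  have hUn : ‖U‖ ≤ 1 := by
    refine (ContinuousLinearMap.opNorm_comp_le _ _).trans ?_
    have := p.orthogonalProjectionOnto_norm_le
    exact mul_le_one₀ hU₀n (norm_nonneg _) this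
  have hU : ∀ x, U (CFC.abs T x) = T x := by
    intro x
    have : p.orthogonalProjectionOnto (CFC.abs T x) = e x :=
      Submodule.orthogonalProjectionOnto_mem_subspace_eq_self (K := p) (e x)
    change U₀ (p.orthogonalProjectionOnto (CFC.abs T x)) = T x
    rw [this, hU₀]
  refine ⟨U, hUn, hU, fun x => ?_⟩
  set w := CFC.abs T x with hw
  have h1 : ‖ContinuousLinearMap.adjoint U (T x)‖ ≤ ‖w‖ := by
    have h := (ContinuousLinearMap.adjoint U).le_of_opNorm_le (c := 1) (by simpa using hUn) (T x)
    rwa [one_mul, ← norm_abs_apply T] at h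
  have h2 : ⟪ContinuousLinearMap.adjoint U (T x), w⟫_ℂ = (‖w‖ : ℂ) ^ 2 := by
    rw [ContinuousLinearMap.adjoint_inner_left, hU, inner_self_eq_norm_sq_to_K,
      ← norm_abs_apply T x]
    rfl
  have h3 := @norm_sub_sq ℂ _ _ _ _ (ContinuousLinearMap.adjoint U (T x)) w
  rw [h2] at h3
  have h4 : RCLike.re ((‖w‖ : ℂ) ^ 2) = ‖w‖ ^ 2 := by
    rw [← Complex.ofReal_pow]; rfl
  rw [h4] at h3
  have h5 : ‖ContinuousLinearMap.adjoint U (T x)‖ ^ 2 ≤ ‖w‖ ^ 2 := by gcongr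
  have h6 : ‖ContinuousLinearMap.adjoint U (T x) - w‖ ^ 2 = 0 :=
    le_antisymm (by linarith) (sq_nonneg _)
  exact sub_eq_zero.mp (norm_eq_zero.mp (pow_eq_zero_iff two_ne_zero |>.mp h6))

/-- `∑ |⟨k|L T|k⟩| ≤ ‖T‖₁` for a contraction `L`. -/
theorem tsum_inner_le {ι : Type*} (b : HilbertBasis ι ℂ H) (T L : H →L[ℂ] H) (hL : ‖L‖ ≤ 1) :
    ∑' i, ‖⟪b i, L (T (b i))⟫_ℂ‖ₑ ≤ eTraceNorm T := by
  obtain ⟨U, hU, hUT, -⟩ := exists_polar T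
  set Q := CFC.sqrt (CFC.abs T) with hQ
  have hQs : ContinuousLinearMap.adjoint Q = Q :=
    (CFC.sqrt_nonneg (CFC.abs T)).isSelfAdjoint.adjoint_eq
  have hQQ : ∀ x, Q (Q x) = CFC.abs T x := fun x =>
    congrArg (fun S : H →L[ℂ] H => S x) (CFC.sqrt_mul_sqrt_self (CFC.abs T) (CFC.abs_nonneg T))
  set A := ContinuousLinearMap.adjoint (L ∘L U) with hA
  have hAn : ‖A‖ ≤ 1 := by
    rw [hA, LinearIsometryEquiv.norm_map]
    exact (ContinuousLinearMap.opNorm_comp_le _ _).trans (mul_le_one₀ hL (norm_nonneg _) hU)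
  have key : ∀ i, ‖⟪b i, L (T (b i))⟫_ℂ‖ₑ ≤
      (1 / 2) * ‖Q (A (b i))‖ₑ ^ 2 + (1 / 2) * ‖Q (b i)‖ₑ ^ 2 := by
    intro i
    have h1 : ⟪b i, L (T (b i))⟫_ℂ = ⟪Q (A (b i)), Q (b i)⟫_ℂ := by
      rw [← hUT, ← hQQ]
      conv_rhs => rw [← hQs, ContinuousLinearMap.adjoint_inner_left, hA,
        ContinuousLinearMap.adjoint_inner_left, hQs]
      rfl
    have h2 : ‖⟪b i, L (T (b i))⟫_ℂ‖ ≤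
        (1 / 2) * ‖Q (A (b i))‖ ^ 2 + (1 / 2) * ‖Q (b i)‖ ^ 2 := by
      rw [h1]
      refine (norm_inner_le_norm _ _).trans ?_
      nlinarith [sq_nonneg (‖Q (A (b i))‖ - ‖Q (b i)‖)]
    have h3 := ENNReal.ofReal_le_ofReal h2
    rw [ENNReal.ofReal_add (by positivity) (by positivity), ENNReal.ofReal_mul (by positivity),
      ENNReal.ofReal_mul (by positivity), ENNReal.ofReal_pow (norm_nonneg _),
      ENNReal.ofReal_pow (norm_nonneg _), ofReal_norm, ofReal_norm, ofReal_norm] at h3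
    have h4 : ENNReal.ofReal (1 / 2) = 1 / 2 := by
      rw [ENNReal.ofReal_div_of_pos two_pos]; simp
    rwa [h4] at h3
  refine (ENNReal.tsum_le_tsum key).trans ?_
  rw [ENNReal.tsum_add, ENNReal.tsum_mul_left, ENNReal.tsum_mul_left]
  calc _ ≤ (1 / 2) * ∑' i, ‖Q (b i)‖ₑ ^ 2 + (1 / 2) * ∑' i, ‖Q (b i)‖ₑ ^ 2 := by
        gcongr ?_ + _
        gcongr 1 / 2 * ?_
        exact hs_comp_le' b Q A hAn
    _ = ∑' i, ‖Q (b i)‖ₑ ^ 2 := by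
        rw [← add_mul, ENNReal.add_halves, one_mul]
    _ = eTraceNorm T := (eTraceNorm_eq b T).symm

theorem eTraceNorm_zero : eTraceNorm (0 : H →L[ℂ] H) = 0 := by
  simp [eTraceNorm]

theorem eTraceNorm_add_le (S T : H →L[ℂ] H) :
    eTraceNorm (S + T) ≤ eTraceNorm S + eTraceNorm T := by
  obtain ⟨U, hU, -, hUT⟩ := exists_polar (S + T)
  have hU' : ‖ContinuousLinearMap.adjoint U‖ ≤ 1 := by simpa using hU
  refine le_trans ?_ (add_le_add (tsum_inner_le (stdBasis H) S _ hU')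
    (tsum_inner_le (stdBasis H) T _ hU'))
  rw [← ENNReal.tsum_add]
  refine ENNReal.tsum_le_tsum fun i => ?_
  rw [← hUT, add_apply, map_add, inner_add_right]
  refine le_trans ?_ (enorm_add_le _ _)
  rw [← ofReal_norm]
  exact ENNReal.ofReal_le_ofReal (Complex.re_le_norm _)

theorem eTraceNorm_smul (c : ℂ) (T : H →L[ℂ] H) : eTraceNorm (c • T) = ‖c‖ₑ * eTraceNorm T := by
  simp only [eTraceNorm, CFC.abs_smul]
  rw [← ENNReal.tsum_mul_left]
  refine tsum_congr fun i => ?_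
  have : ⟪stdBasis H i, (‖c‖ • CFC.abs T) (stdBasis H i)⟫_ℂ =
      (‖c‖ : ℂ) * ⟪stdBasis H i, CFC.abs T (stdBasis H i)⟫_ℂ := by
    rw [← inner_smul_right]; rfl
  rw [this, Complex.re_ofReal_mul, ENNReal.ofReal_mul (norm_nonneg _), ofReal_norm]

theorem eq_zero_of_eTraceNorm (T : H →L[ℂ] H) (h : eTraceNorm T = 0) : T = 0 := by
  rw [eTraceNorm_eq (stdBasis H), ENNReal.tsum_eq_zero] at h
  have h1 : ∀ i, CFC.sqrt (CFC.abs T) (stdBasis H i) = 0 := fun i => by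
    simpa using h i
  have h2 : CFC.sqrt (CFC.abs T) = 0 := by
    refine ContinuousLinearMap.ext_on (s := Set.range (stdBasis H)) ?_ ?_
    · exact Submodule.dense_iff_topologicalClosure_eq_top.mpr (stdBasis H).dense_span
    · rintro _ ⟨i, rfl⟩
      simpa using h1 i
  have h3 := CFC.sqrt_mul_sqrt_self (CFC.abs T) (CFC.abs_nonneg T)
  rw [h2, zero_mul] at h3
  exact CFC.abs_eq_zero_iff.mp h3.symm


theorem eTraceNorm_eq_basis {ι : Type*} (b : HilbertBasis ι ℂ H) (T : H →L[ℂ] H) :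
    eTraceNorm T = ∑' i, ENNReal.ofReal (⟪b i, CFC.abs T (b i)⟫_ℂ).re := by
  rw [eTraceNorm_eq b]
  exact tsum_congr fun i => (inner_nonneg_op (CFC.abs_nonneg T) _).symm

variable (H) in
/-- The subspace `{T : tr |T| < ∞}` of `B(H)`. -/
def traceClassSubmodule : Submodule ℂ (H →L[ℂ] H) where
  carrier := {T | eTraceNorm T < ∞}
  zero_mem' := by simp [eTraceNorm_zero]
  add_mem' {S T} hS hT := (eTraceNorm_add_le S T).trans_lt (ENNReal.add_lt_top.mpr ⟨hS, hT⟩)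
  smul_mem' c T hT := by
    simp only [Set.mem_ofPred_eq, eTraceNorm_smul]
    exact ENNReal.mul_lt_top enorm_lt_top hT

variable (H) in
/-- The space `𝒯(H)` of trace-class operators on `H`. It carries the trace norm, not the operator
norm. -/
def TraceClass : Type _ := traceClassSubmodule H

namespace TraceClass

instance : AddCommGroup (TraceClass H) := inferInstanceAs (AddCommGroup (traceClassSubmodule H))

instance : Module ℂ (TraceClass H) := inferInstanceAs (Module ℂ (traceClassSubmodule H))

/-- The underlying bounded operator. -/
def op (T : TraceClass H) : H →L[ℂ] H := T.val

/-- A bounded operator with finite trace norm as an element of `𝒯(H)`. -/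
def ofOp (T : H →L[ℂ] H) (hT : eTraceNorm T < ∞) : TraceClass H := ⟨T, hT⟩

@[ext] theorem ext {S T : TraceClass H} (h : S.op = T.op) : S = T := Subtype.ext h

@[simp] theorem op_ofOp (T : H →L[ℂ] H) (hT : eTraceNorm T < ∞) : (ofOp T hT).op = T := rfl

@[simp] theorem op_add (S T : TraceClass H) : (S + T).op = S.op + T.op := rfl

@[simp] theorem op_smul (c : ℂ) (T : TraceClass H) : (c • T).op = c • T.op := rfl

@[simp] theorem op_zero : (0 : TraceClass H).op = 0 := rfl

theorem finite (T : TraceClass H) : eTraceNorm T.op < ∞ := T.property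

/-- The trace norm `‖T‖₁ = tr |T|`. -/
instance : Norm (TraceClass H) := ⟨fun T => (eTraceNorm T.op).toReal⟩

theorem norm_def (T : TraceClass H) : ‖T‖ = (eTraceNorm T.op).toReal := rfl

theorem normCore : NormedSpace.Core ℂ (TraceClass H) where
  norm_nonneg _ := ENNReal.toReal_nonneg
  norm_smul c T := by
    rw [norm_def, norm_def, op_smul, eTraceNorm_smul, ENNReal.toReal_mul, toReal_enorm]
  norm_triangle S T := by
    rw [norm_def, norm_def, norm_def, ← ENNReal.toReal_add S.finite.ne T.finite.ne]
    exact ENNReal.toReal_mono (ENNReal.add_lt_top.mpr ⟨S.finite, T.finite⟩).ne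
      (eTraceNorm_add_le _ _)
  norm_eq_zero_iff T := by
    constructor
    · intro h
      refine ext (eq_zero_of_eTraceNorm _ ?_)
      exact (ENNReal.toReal_eq_zero_iff _).mp h |>.resolve_right T.finite.ne
    · rintro rfl
      simp [norm_def, eTraceNorm_zero]

instance : NormedAddCommGroup (TraceClass H) := NormedAddCommGroup.ofCore normCore

instance : NormedSpace ℂ (TraceClass H) := NormedSpace.ofCore normCore

end TraceClass

/-- Transport of an operator along a unitary: `T ↦ U T U†`. -/
def conjOp (U : H ≃ₗᵢ[ℂ] K) (T : H →L[ℂ] H) : K →L[ℂ] K := U.conjStarAlgEquiv T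

@[simp] theorem conjOp_apply (U : H ≃ₗᵢ[ℂ] K) (T : H →L[ℂ] H) (x : K) :
    conjOp U T x = U (T (U.symm x)) := U.conjStarAlgEquiv_apply_apply T x

theorem conjOp_abs (U : H ≃ₗᵢ[ℂ] K) (T : H →L[ℂ] H) :
    CFC.abs (conjOp U T) = conjOp U (CFC.abs T) := by
  refine CFC.sqrt_unique ?_ (map_nonneg U.conjStarAlgEquiv (CFC.abs_nonneg T))
  simp only [conjOp]
  rw [← map_mul, CFC.abs_mul_abs, map_mul, map_star]

theorem eTraceNorm_conjOp (U : H ≃ₗᵢ[ℂ] K) (T : H →L[ℂ] H) :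
    eTraceNorm (conjOp U T) = eTraceNorm T := by
  let b : HilbertBasis (basisIndex H) ℂ K := .ofRepr (U.symm.trans (stdBasis H).repr)
  have hb : ∀ i, b i = U (stdBasis H i) := by
    intro i
    classical
    rw [← b.repr_symm_single, ← (stdBasis H).repr_symm_single]
    rfl
  rw [eTraceNorm_eq_basis b, eTraceNorm, conjOp_abs]
  refine tsum_congr fun i => ?_
  rw [hb, conjOp_apply, U.symm_apply_apply, U.inner_map_map]

/-- `T ↦ U T U†` on trace-class operators. -/
def TraceClass.conj (U : H ≃ₗᵢ[ℂ] K) (T : TraceClass H) : TraceClass K :=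
  .ofOp (conjOp U T.op) (by rw [eTraceNorm_conjOp]; exact T.finite)

/-- Density operators: positive semidefinite trace-class operators of trace one. -/
def densityOperators (H : Type*) [NormedAddCommGroup H] [InnerProductSpace ℂ H]
    [CompleteSpace H] : Set (TraceClass H) :=
  {ρ | ρ.op.IsPositive ∧ opTrace ρ.op = 1}

end TraceClass

/-! ### Tensor products -/

section Tensor

variable (A B : Type*) [NormedAddCommGroup A] [InnerProductSpace ℂ A] [CompleteSpace A]
  [NormedAddCommGroup B] [InnerProductSpace ℂ B] [CompleteSpace B]

/-- The Hilbert space tensor product: completion of the algebraic tensor product with respect to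
`⟨x ⊗ y, x' ⊗ y'⟩ = ⟨x, x'⟩ ⟨y, y'⟩`. -/
def HTensor : Type _ := UniformSpace.Completion (TensorProduct ℂ A B)

namespace HTensor

instance : NormedAddCommGroup (HTensor A B) :=
  inferInstanceAs (NormedAddCommGroup (UniformSpace.Completion (TensorProduct ℂ A B)))

instance : InnerProductSpace ℂ (HTensor A B) :=
  inferInstanceAs (InnerProductSpace ℂ (UniformSpace.Completion (TensorProduct ℂ A B)))

instance : CompleteSpace (HTensor A B) :=
  inferInstanceAs (CompleteSpace (UniformSpace.Completion (TensorProduct ℂ A B)))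

/-- The isometric inclusion of the algebraic tensor product. -/
def incl : TensorProduct ℂ A B →ₗᵢ[ℂ] HTensor A B := UniformSpace.Completion.toComplₗᵢ

theorem denseRange_incl : DenseRange (incl A B) := UniformSpace.Completion.denseRange_coe

end HTensor

variable {A B}

/-- The elementary tensor `x ⊗ y`. -/
def hmk (x : A) (y : B) : HTensor A B := HTensor.incl A B (x ⊗ₜ[ℂ] y)

open TensorProduct in
theorem inner_map_left (S : A →L[ℂ] A) (T : B →L[ℂ] B) (z w : A ⊗[ℂ] B) :
    ⟪TensorProduct.map S.toLinearMap T.toLinearMap z, w⟫_ℂ =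
      ⟪z, TensorProduct.map (star S).toLinearMap (star T).toLinearMap w⟫_ℂ := by
  induction z with
  | zero => simp
  | add z z' h h' => rw [map_add, inner_add_left, inner_add_left, h, h']
  | tmul x y =>
    induction w with
    | zero => simp
    | add w w' h h' => rw [map_add, inner_add_right, inner_add_right, h, h']
    | tmul x' y' =>
      simp only [TensorProduct.map_tmul, TensorProduct.inner_tmul, ContinuousLinearMap.coe_coe,
        ContinuousLinearMap.star_eq_adjoint, ContinuousLinearMap.adjoint_inner_right]


open TensorProduct in
theorem norm_map_left_le (S : A →L[ℂ] A) (z : A ⊗[ℂ] B) :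
    ‖TensorProduct.map S.toLinearMap (1 : B →L[ℂ] B).toLinearMap z‖ ≤ ‖S‖ * ‖z‖ := by
  have hle : star S * S ≤ algebraMap ℝ (A →L[ℂ] A) (‖S‖ ^ 2) := by
    have := (IsSelfAdjoint.star_mul_self S).le_algebraMap_norm_self
    rwa [CStarRing.norm_star_mul_self, ← pow_two] at this
  set P : A →L[ℂ] A := algebraMap ℝ (A →L[ℂ] A) (‖S‖ ^ 2) - star S * S with hP
  have hP0 : 0 ≤ P := sub_nonneg.mpr hle
  have hR : star (CFC.sqrt P) * CFC.sqrt P = P := by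
    rw [(CFC.sqrt_nonneg P).isSelfAdjoint.star_eq, CFC.sqrt_mul_sqrt_self P hP0]
  have comp : ∀ (X Y : A →L[ℂ] A) (w : A ⊗[ℂ] B),
      TensorProduct.map X.toLinearMap (1 : B →L[ℂ] B).toLinearMap
        (TensorProduct.map Y.toLinearMap (1 : B →L[ℂ] B).toLinearMap w) =
      TensorProduct.map (X * Y).toLinearMap (1 : B →L[ℂ] B).toLinearMap w := by
    intro X Y w
    rw [← LinearMap.comp_apply, ← TensorProduct.map_comp]
    rfl
  have nsq : ∀ X : A →L[ℂ] A,
      ((‖TensorProduct.map X.toLinearMap (1 : B →L[ℂ] B).toLinearMap z‖ : ℂ)) ^ 2 =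
      ⟪z, TensorProduct.map (star X * X).toLinearMap (1 : B →L[ℂ] B).toLinearMap z⟫_ℂ := by
    intro X
    rw [← comp, ← star_one (R := B →L[ℂ] B), ← inner_map_left, star_one]
    exact (inner_self_eq_norm_sq_to_K (𝕜 := ℂ) (E := A ⊗[ℂ] B) _).symm
  have hsum : ((‖TensorProduct.map (CFC.sqrt P).toLinearMap (1 : B →L[ℂ] B).toLinearMap z‖ : ℂ)) ^ 2
      + ((‖TensorProduct.map S.toLinearMap (1 : B →L[ℂ] B).toLinearMap z‖ : ℂ)) ^ 2 =
      ((‖S‖ * ‖z‖ : ℝ) : ℂ) ^ 2 := by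
    rw [nsq, nsq, hR]
    refine (inner_add_right (𝕜 := ℂ) (E := A ⊗[ℂ] B) _ _ _).symm.trans ?_
    rw [← LinearMap.add_apply, ← TensorProduct.map_add_left]
    have : P.toLinearMap + (star S * S).toLinearMap = ((‖S‖ ^ 2 : ℝ) : ℂ) • LinearMap.id := by
      ext x
      simp only [hP, Algebra.algebraMap_eq_smul_one, LinearMap.add_apply,
        ContinuousLinearMap.coe_coe, _root_.sub_apply, _root_.smul_apply,
        one_apply_eq_self, sub_add_cancel, LinearMap.smul_apply, LinearMap.id_apply]
      exact (Complex.coe_smul (‖S‖ ^ 2) x).symm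
    rw [this, TensorProduct.map_smul_left]
    have h1 : TensorProduct.map (LinearMap.id : A →ₗ[ℂ] A) (1 : B →L[ℂ] B).toLinearMap z = z :=
      congrArg (fun f : A ⊗[ℂ] B →ₗ[ℂ] A ⊗[ℂ] B => f z) TensorProduct.map_id
    rw [LinearMap.smul_apply, h1]
    refine (inner_smul_right (𝕜 := ℂ) (E := A ⊗[ℂ] B) _ _ _).trans ?_
    have h2 : ⟪z, z⟫_ℂ = (‖z‖ : ℂ) ^ 2 := inner_self_eq_norm_sq_to_K (𝕜 := ℂ) (E := A ⊗[ℂ] B) z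
    rw [h2]
    push_cast
    ring
  have hsum' : ‖TensorProduct.map (CFC.sqrt P).toLinearMap (1 : B →L[ℂ] B).toLinearMap z‖ ^ 2
      + ‖TensorProduct.map S.toLinearMap (1 : B →L[ℂ] B).toLinearMap z‖ ^ 2 =
      (‖S‖ * ‖z‖) ^ 2 := by exact_mod_cast hsum
  refine (pow_le_pow_iff_left₀ (norm_nonneg _) (by positivity) two_ne_zero).mp ?_
  nlinarith [sq_nonneg ‖TensorProduct.map (CFC.sqrt P).toLinearMap
    (1 : B →L[ℂ] B).toLinearMap z‖]

open TensorProduct in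
theorem norm_map_le (S : A →L[ℂ] A) (T : B →L[ℂ] B) (z : A ⊗[ℂ] B) :
    ‖TensorProduct.map S.toLinearMap T.toLinearMap z‖ ≤ ‖S‖ * ‖T‖ * ‖z‖ := by
  have h1 : TensorProduct.map S.toLinearMap T.toLinearMap z =
      TensorProduct.map S.toLinearMap (1 : B →L[ℂ] B).toLinearMap
        (TensorProduct.map (1 : A →L[ℂ] A).toLinearMap T.toLinearMap z) := by
    rw [← LinearMap.comp_apply, ← TensorProduct.map_comp]
    rfl
  have h2 : ‖TensorProduct.map (1 : A →L[ℂ] A).toLinearMap T.toLinearMap z‖ ≤ ‖T‖ * ‖z‖ := by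
    have := norm_map_left_le (B := A) T (TensorProduct.comm ℂ A B z)
    rw [TensorProduct.norm_comm, TensorProduct.map_comm, TensorProduct.norm_comm] at this
    exact this
  rw [h1, mul_assoc]
  exact (norm_map_left_le S _).trans (by gcongr)

/-- `S ⊗ T` on the algebraic tensor product, as a bounded operator. -/
def algTensorOp (S : A →L[ℂ] A) (T : B →L[ℂ] B) :
    TensorProduct ℂ A B →L[ℂ] TensorProduct ℂ A B :=
  LinearMap.mkContinuous (TensorProduct.map S.toLinearMap T.toLinearMap) (‖S‖ * ‖T‖)
    (norm_map_le S T)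

/-- The operator `S ⊗ T` on the Hilbert space tensor product: the bounded operator with
`(S ⊗ T)(x ⊗ y) = S x ⊗ T y`. -/
def tensorOp (S : A →L[ℂ] A) (T : B →L[ℂ] B) : HTensor A B →L[ℂ] HTensor A B :=
  ((HTensor.incl A B).toContinuousLinearMap ∘L algTensorOp S T).extend
    (HTensor.incl A B).toContinuousLinearMap

theorem tensorOp_incl (S : A →L[ℂ] A) (T : B →L[ℂ] B) (z : TensorProduct ℂ A B) :
    tensorOp S T (HTensor.incl A B z) =
      HTensor.incl A B (TensorProduct.map S.toLinearMap T.toLinearMap z) :=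
  ContinuousLinearMap.extend_eq _ (HTensor.denseRange_incl A B)
    (HTensor.incl A B).isometry.isUniformInducing z

@[simp] theorem tensorOp_hmk (S : A →L[ℂ] A) (T : B →L[ℂ] B) (x : A) (y : B) :
    tensorOp S T (hmk x y) = hmk (S x) (T y) := by
  rw [hmk, tensorOp_incl, TensorProduct.map_tmul]
  rfl

theorem inner_hmk (x x' : A) (y y' : B) :
    ⟪hmk x y, hmk x' y'⟫_ℂ = ⟪x, x'⟫_ℂ * ⟪y, y'⟫_ℂ := by
  rw [hmk, hmk, LinearIsometry.inner_map_map, TensorProduct.inner_tmul]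

theorem tensorOp_mul (S S' : A →L[ℂ] A) (T T' : B →L[ℂ] B) :
    tensorOp (S * S') (T * T') = tensorOp S T * tensorOp S' T' := by
  refine ContinuousLinearMap.ext fun z => ?_
  refine (HTensor.denseRange_incl A B).induction_on z
    (isClosed_eq (ContinuousLinearMap.continuous _) (ContinuousLinearMap.continuous _)) fun a => ?_
  change _ = tensorOp S T (tensorOp S' T' (HTensor.incl A B a))
  rw [tensorOp_incl, tensorOp_incl, tensorOp_incl, ← LinearMap.comp_apply,
    ← TensorProduct.map_comp]
  rfl

theorem tensorOp_star (S : A →L[ℂ] A) (T : B →L[ℂ] B) :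
    star (tensorOp S T) = tensorOp (star S) (star T) := by
  rw [ContinuousLinearMap.star_eq_adjoint, eq_comm, ContinuousLinearMap.eq_adjoint_iff]
  intro x y
  refine (HTensor.denseRange_incl A B).induction_on x (isClosed_eq (by fun_prop) (by fun_prop))
    fun a => ?_
  refine (HTensor.denseRange_incl A B).induction_on y (isClosed_eq (by fun_prop) (by fun_prop))
    fun b => ?_
  rw [tensorOp_incl, tensorOp_incl, LinearIsometry.inner_map_map,
    LinearIsometry.inner_map_map, inner_map_left, star_star, star_star]

theorem tensorOp_nonneg {P : A →L[ℂ] A} {Q : B →L[ℂ] B} (hP : 0 ≤ P) (hQ : 0 ≤ Q) :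
    0 ≤ tensorOp P Q := by
  have h : tensorOp P Q =
      star (tensorOp (CFC.sqrt P) (CFC.sqrt Q)) * tensorOp (CFC.sqrt P) (CFC.sqrt Q) := by
    rw [tensorOp_star, (CFC.sqrt_nonneg P).isSelfAdjoint.star_eq,
      (CFC.sqrt_nonneg Q).isSelfAdjoint.star_eq, ← tensorOp_mul, CFC.sqrt_mul_sqrt_self P hP,
      CFC.sqrt_mul_sqrt_self Q hQ]
  rw [h]
  exact star_mul_self_nonneg _

theorem tensorOp_abs (S : A →L[ℂ] A) (T : B →L[ℂ] B) :
    CFC.abs (tensorOp S T) = tensorOp (CFC.abs S) (CFC.abs T) := by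
  refine CFC.sqrt_unique ?_ (tensorOp_nonneg (CFC.abs_nonneg S) (CFC.abs_nonneg T))
  rw [← tensorOp_mul, CFC.abs_mul_abs, CFC.abs_mul_abs, tensorOp_mul, tensorOp_star]

/-- The product of two Hilbert bases. -/
theorem exists_productBasis {ι κ : Type*} (b : HilbertBasis ι ℂ A) (c : HilbertBasis κ ℂ B) :
    ∃ e : HilbertBasis (ι × κ) ℂ (HTensor A B), ∀ p, e p = hmk (b p.1) (c p.2) := by
  have ho : Orthonormal ℂ fun p : ι × κ => hmk (b p.1) (c p.2) := by
    classical
    rw [orthonormal_iff_ite]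
    rintro ⟨i, j⟩ ⟨i', j'⟩
    rw [inner_hmk, orthonormal_iff_ite.mp b.orthonormal, orthonormal_iff_ite.mp c.orthonormal]
    simp only [Prod.mk.injEq]
    split_ifs <;> simp_all
  have hsp : ⊤ ≤ (Submodule.span ℂ
      (Set.range fun p : ι × κ => hmk (b p.1) (c p.2))).topologicalClosure := by
    set M := (Submodule.span ℂ
      (Set.range fun p : ι × κ => hmk (b p.1) (c p.2))).topologicalClosure with hM
    have hMc : IsClosed (M : Set (HTensor A B)) := Submodule.isClosed_topologicalClosure _
    have cont : ∀ x : A, Continuous fun y : B => hmk x y := fun x =>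
      (HTensor.incl A B).continuous.comp
        (TensorProduct.continuous_tmul.comp (Continuous.prodMk_right x))
    have cont' : ∀ y : B, Continuous fun x : A => hmk x y := fun y =>
      (HTensor.incl A B).continuous.comp
        (TensorProduct.continuous_tmul.comp (Continuous.prodMk_left y))
    have h1 : ∀ i y, hmk (b i) y ∈ M := by
      intro i y
      let f : B →ₗ[ℂ] HTensor A B :=
        { toFun := fun y => hmk (b i) y
          map_add' := fun y y' => by
            simp only [hmk, TensorProduct.tmul_add, map_add]
          map_smul' := fun r y => by
            simp only [hmk, TensorProduct.tmul_smul, map_smul,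
              RingHom.id_apply] }
      have hcl : IsClosed ((M.comap f : Submodule ℂ B) : Set B) := hMc.preimage (cont (b i))
      have hle : (Submodule.span ℂ (Set.range c)).topologicalClosure ≤ M.comap f := by
        refine Submodule.topologicalClosure_minimal _ (Submodule.span_le.mpr ?_) hcl
        rintro _ ⟨j, rfl⟩
        exact Submodule.le_topologicalClosure _ (Submodule.subset_span ⟨(i, j), rfl⟩)
      rw [c.dense_span] at hle
      exact hle (Submodule.mem_top (x := y))
    have h2 : ∀ x y, hmk x y ∈ M := by
      intro x y
      let f : A →ₗ[ℂ] HTensor A B :=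
        { toFun := fun x => hmk x y
          map_add' := fun y y' => by
            simp only [hmk, TensorProduct.add_tmul, map_add]
          map_smul' := fun r y => by
            simp only [hmk, ← TensorProduct.smul_tmul', map_smul,
              RingHom.id_apply] }
      have hcl : IsClosed ((M.comap f : Submodule ℂ A) : Set A) := hMc.preimage (cont' y)
      have hle : (Submodule.span ℂ (Set.range b)).topologicalClosure ≤ M.comap f := by
        refine Submodule.topologicalClosure_minimal _ (Submodule.span_le.mpr ?_) hcl
        rintro _ ⟨i, rfl⟩
        exact h1 i y
      rw [b.dense_span] at hle
      exact hle (Submodule.mem_top (x := x))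
    intro z _
    refine (HTensor.denseRange_incl A B).induction_on z hMc fun a => ?_
    induction a with
    | zero => rw [map_zero]; exact M.zero_mem
    | tmul x y => exact h2 x y
    | add a a' h h' =>
      rw [map_add]
      exact M.add_mem h h'
  refine ⟨HilbertBasis.mk ho hsp, fun p => ?_⟩
  rw [HilbertBasis.coe_mk]

theorem eTraceNorm_tensorOp (S : A →L[ℂ] A) (T : B →L[ℂ] B) :
    eTraceNorm (tensorOp S T) = eTraceNorm S * eTraceNorm T := by
  obtain ⟨e, he⟩ := exists_productBasis (stdBasis A) (stdBasis B)
  rw [eTraceNorm_eq_basis e, tensorOp_abs, eTraceNorm, eTraceNorm, ENNReal.tsum_prod',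
    ← ENNReal.tsum_mul_right]
  refine tsum_congr fun i => ?_
  rw [← ENNReal.tsum_mul_left]
  refine tsum_congr fun j => ?_
  rw [he, tensorOp_hmk, inner_hmk]
  have hS := ((ContinuousLinearMap.nonneg_iff_isPositive _).mp (CFC.abs_nonneg S)).inner_nonneg_right
    (stdBasis A i)
  have hT := ((ContinuousLinearMap.nonneg_iff_isPositive _).mp (CFC.abs_nonneg T)).inner_nonneg_right
    (stdBasis B j)
  rw [Complex.le_def] at hS hT
  rw [← ENNReal.ofReal_mul hS.1, Complex.mul_re, ← hS.2, ← hT.2]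
  simp

/-- The tensor product of trace-class operators. -/
def TraceClass.tensor (S : TraceClass A) (T : TraceClass B) : TraceClass (HTensor A B) :=
  .ofOp (tensorOp S.op T.op) (by
    rw [eTraceNorm_tensorOp]
    exact ENNReal.mul_lt_top S.finite T.finite)

end Tensor

/-! ### Quantum channels -/

section Channel

variable {H K L : Type*} [NormedAddCommGroup H] [InnerProductSpace ℂ H] [CompleteSpace H]
  [NormedAddCommGroup K] [InnerProductSpace ℂ K] [CompleteSpace K]
  [NormedAddCommGroup L] [InnerProductSpace ℂ L] [CompleteSpace L]

/-- The `n × n` block operator `(T j k)` is positive on `H ⊕ ⋯ ⊕ H = ℂⁿ ⊗ H`. -/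
def BlockPositive {n : ℕ} (T : Fin n → Fin n → TraceClass H) : Prop :=
  ∀ v : Fin n → H, 0 ≤ ∑ j, ∑ k, ⟪v j, (T j k).op (v k)⟫_ℂ

variable (H K) in
/-- Completely positive and trace-preserving linear maps `𝒯(H) → 𝒯(K)`. -/
structure Channel where
  /-- The underlying linear map. -/
  toLin : TraceClass H →ₗ[ℂ] TraceClass K
  /-- Complete positivity: `id ⊗ Φ` is positive on `Mₙ(ℂ) ⊗ 𝒯(H)` for every `n`. -/
  completelyPositive : ∀ (n : ℕ) (T : Fin n → Fin n → TraceClass H), BlockPositive T →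
    BlockPositive fun j k => toLin (T j k)
  tracePreserving : ∀ T, opTrace (toLin T).op = opTrace T.op

instance : CoeFun (Channel H K) fun _ => TraceClass H → TraceClass K := ⟨fun Φ => Φ.toLin⟩

variable (H) in
/-- The identity channel. -/
def Channel.id : Channel H H where
  toLin := LinearMap.id
  completelyPositive _ _ h := h
  tracePreserving _ := rfl

/-- Composition of channels, `Ψ ∘ Φ`. -/
def Channel.comp (Ψ : Channel K L) (Φ : Channel H K) : Channel H L where
  toLin := Ψ.toLin ∘ₗ Φ.toLin
  completelyPositive n _ h := Ψ.completelyPositive n _ (Φ.completelyPositive n _ h)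
  tracePreserving T := (Ψ.tracePreserving _).trans (Φ.tracePreserving T)

/-- The bounded weak (BW) topology: the weakest topology that makes `Φ ↦ tr[Φ(T) M]` continuous
for all trace-class `T` and all bounded `M`. -/
instance : TopologicalSpace (Channel H K) :=
  TopologicalSpace.induced
    (fun Φ (p : TraceClass H × (K →L[ℂ] K)) => opTrace ((Φ p.1).op * p.2)) Pi.topologicalSpace

end Channel

/-! ### Quantum resource theories -/

/-- A collection of quantum systems: every system `a` has a complex Hilbert space `space a` of
arbitrary dimension; there is a trivial system with space `ℂ`, and every two systems `a`, `b` have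
a composite `tensor a b` with space `space a ⊗ space b`. -/
structure Systems where
  /-- The quantum systems. -/
  Sys : Type v
  /-- The Hilbert space of a system. -/
  space : Sys → Type u
  [normed : ∀ a, NormedAddCommGroup (space a)]
  [innerProd : ∀ a, InnerProductSpace ℂ (space a)]
  [complete : ∀ a, CompleteSpace (space a)]
  /-- The trivial system. -/
  unit : Sys
  unitIso : space unit ≃ₗᵢ[ℂ] ℂ
  /-- The composite of two systems. -/
  tensor : Sys → Sys → Sys
  tensorIso : ∀ a b, space (tensor a b) ≃ₗᵢ[ℂ] HTensor (space a) (space b)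

attribute [instance] Systems.normed Systems.innerProd Systems.complete

namespace Systems

variable (Q : Systems.{u, v}) {a b : Q.Sys}

/-- The vector `x ⊗ y` of a composite system. -/
def tmul (x : Q.space a) (y : Q.space b) : Q.space (Q.tensor a b) :=
  (Q.tensorIso a b).symm (hmk x y)

/-- The bounded operator `X ⊗ Y` on a composite system. -/
def top (X : Q.space a →L[ℂ] Q.space a) (Y : Q.space b →L[ℂ] Q.space b) :
    Q.space (Q.tensor a b) →L[ℂ] Q.space (Q.tensor a b) :=
  conjOp (Q.tensorIso a b).symm (tensorOp X Y)

/-- The trace-class operator `S ⊗ T` on a composite system. -/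
def tens (S : TraceClass (Q.space a)) (T : TraceClass (Q.space b)) :
    TraceClass (Q.space (Q.tensor a b)) :=
  TraceClass.conj (Q.tensorIso a b).symm (S.tensor T)

theorem eTraceNorm_unit : eTraceNorm (1 : Q.space Q.unit →L[ℂ] Q.space Q.unit) < ∞ := by
  have h : conjOp Q.unitIso (1 : Q.space Q.unit →L[ℂ] Q.space Q.unit) = 1 :=
    map_one Q.unitIso.conjStarAlgEquiv
  rw [← eTraceNorm_conjOp Q.unitIso, h,
    eTraceNorm_eq_basis (OrthonormalBasis.singleton Unit ℂ).toHilbertBasis, tsum_fintype]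
  exact ENNReal.sum_lt_top.mpr fun _ _ => ENNReal.ofReal_lt_top

/-- The unique state `1` of the trivial system. -/
def unitState : TraceClass (Q.space Q.unit) := .ofOp 1 Q.eTraceNorm_unit

/-- The `n`-fold composite `a ⊗ ⋯ ⊗ a`. -/
def tpow (a : Q.Sys) : ℕ → Q.Sys
  | 0 => Q.unit
  | n + 1 => Q.tensor (tpow a n) a

/-- The `n`-fold tensor power `T ⊗ ⋯ ⊗ T`, with `T^{⊗0} = 1`. -/
def spow (T : TraceClass (Q.space a)) : (n : ℕ) → TraceClass (Q.space (Q.tpow a n))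
  | 0 => Q.unitState
  | n + 1 => Q.tens (spow T n) T

/-- `S` and `T` are the reductions `ρ^A = tr_B ρ` and `ρ^B = tr_A ρ` of the operator `ρ` of a
composite system `A ⊗ B`. -/
def IsReduction (ρ : TraceClass (Q.space (Q.tensor a b))) (S : TraceClass (Q.space a))
    (T : TraceClass (Q.space b)) : Prop :=
  (∀ X, opTrace (S.op * X) = opTrace (ρ.op * Q.top X 1)) ∧
  (∀ Y, opTrace (T.op * Y) = opTrace (ρ.op * Q.top 1 Y))

end Systems

/-- A quantum resource theory: for every system a compact set of allowed states, and for every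
pair of systems a BW-compact set of free operations between them. -/
structure QRT extends Systems.{u, v} where
  /-- The set `𝒮(H)` of states under consideration, compact in trace norm. -/
  states : ∀ a : Sys, Set (TraceClass (space a))
  states_subset : ∀ a, states a ⊆ densityOperators (space a)
  states_compact : ∀ a, IsCompact (states a)
  states_tensor : ∀ {a b : Sys}, ∀ S ∈ states a, ∀ T ∈ states b,
    toSystems.tens S T ∈ states (tensor a b)
  /-- The set `𝒪(H → K)` of free operations. -/
  free : ∀ a b : Sys, Set (Channel (space a) (space b))
  free_compact : ∀ a b, IsCompact (free a b)
  free_map : ∀ {a b : Sys}, ∀ Φ ∈ free a b, ∀ S ∈ states a, Φ S ∈ states b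
  free_id : ∀ a, Channel.id (space a) ∈ free a a
  free_comp : ∀ {a b c : Sys}, ∀ Ψ ∈ free b c, ∀ Φ ∈ free a b, Ψ.comp Φ ∈ free a c
  /-- `M ⊗ N`, the channel with `(M ⊗ N)(S ⊗ T) = M(S) ⊗ N(T)`, is free for free `M` and `N`. -/
  free_tensor : ∀ {a a' b b' : Sys}, ∀ M ∈ free a a', ∀ N ∈ free b b',
    ∀ Φ : Channel (space (tensor a b)) (space (tensor a' b')),
      (∀ S T, Φ (toSystems.tens S T) = toSystems.tens (M S) (N T)) → Φ ∈ free _ _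
  /-- The trace, viewed as a channel to the trivial system, is free. -/
  free_trace : ∀ {a : Sys} (Φ : Channel (space a) (space unit)),
    (∀ T, (Φ T).op = opTrace T.op • 1) → Φ ∈ free a unit
  /-- The canonical identification of `H ⊗ ℂ` with `H` is free in both directions. -/
  free_rightUnit : ∀ {a : Sys} (U : space (tensor a unit) ≃ₗᵢ[ℂ] space a),
    (∀ x z, U (toSystems.tmul x z) = unitIso z • x) →
    (∀ Φ : Channel _ _, (∀ T, Φ T = TraceClass.conj U T) → Φ ∈ free (tensor a unit) a) ∧
    (∀ Φ : Channel _ _, (∀ T, Φ T = TraceClass.conj U.symm T) → Φ ∈ free a (tensor a unit))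
  /-- The canonical identification of `ℂ ⊗ H` with `H` is free in both directions. -/
  free_leftUnit : ∀ {a : Sys} (U : space (tensor unit a) ≃ₗᵢ[ℂ] space a),
    (∀ z x, U (toSystems.tmul z x) = unitIso z • x) →
    (∀ Φ : Channel _ _, (∀ T, Φ T = TraceClass.conj U T) → Φ ∈ free (tensor unit a) a) ∧
    (∀ Φ : Channel _ _, (∀ T, Φ T = TraceClass.conj U.symm T) → Φ ∈ free a (tensor unit a))
  /-- The canonical identification of `(A ⊗ B) ⊗ C` with `A ⊗ (B ⊗ C)` is free in both
  directions. -/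
  free_assoc : ∀ {a b c : Sys}
    (U : space (tensor (tensor a b) c) ≃ₗᵢ[ℂ] space (tensor a (tensor b c))),
    (∀ x y z, U (toSystems.tmul (toSystems.tmul x y) z) =
      toSystems.tmul x (toSystems.tmul y z)) →
    (∀ Φ : Channel _ _, (∀ T, Φ T = TraceClass.conj U T) →
      Φ ∈ free (tensor (tensor a b) c) (tensor a (tensor b c))) ∧
    (∀ Φ : Channel _ _, (∀ T, Φ T = TraceClass.conj U.symm T) →
      Φ ∈ free (tensor a (tensor b c)) (tensor (tensor a b) c))

namespace QRT

variable (Q : QRT.{u, v}) {a b : Q.Sys}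

/-- `φ ≽ ψ`: a single free operation on the system takes `φ` to `ψ`. -/
def Converts (φ ψ : TraceClass (Q.space a)) : Prop := ∃ N ∈ Q.free a a, N φ = ψ

/-- The set `𝒢(H)` of maximally resourceful states: no state lies strictly above them. -/
def maximal (a : Q.Sys) : Set (TraceClass (Q.space a)) :=
  {φ | φ ∈ Q.states a ∧ ∀ ψ ∈ Q.states a, Q.Converts ψ φ → Q.Converts φ ψ}

/-- The set `ℱ(H)` of free states: those obtained by a free operation from every state of every
system. -/
def freeStates (a : Q.Sys) : Set (TraceClass (Q.space a)) :=
  {ψ | ψ ∈ Q.states a ∧ ∀ b, ∀ φ ∈ Q.states b, ∃ N ∈ Q.free b a, N φ = ψ}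

/-- The set of achievable rates of asymptotic conversion from `φ` to `ψ`. -/
def rates (φ : TraceClass (Q.space a)) (ψ : TraceClass (Q.space b)) : Set ℝ≥0 :=
  {r | ∃ N : ∀ n : ℕ, Channel (Q.space (Q.tpow a n)) (Q.space (Q.tpow b ⌈r * n⌉₊)),
    (∀ n, N n ∈ Q.free _ _) ∧
    Filter.liminf (fun n : ℕ => ‖N n (Q.spow φ n) - Q.spow ψ ⌈r * n⌉₊‖ₑ) Filter.atTop = 0}

/-- The asymptotic conversion rate `r_conv(φ → ψ) ∈ [0, ∞]`. -/
def rconv (φ : TraceClass (Q.space a)) (ψ : TraceClass (Q.space b)) : ℝ≥0∞ :=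
  ⨆ r ∈ Q.rates φ ψ, (r : ℝ≥0∞)

/-- A resource (non-free) state that can be replicated at an unbounded rate from itself. -/
def IsCatalyticallyReplicable (ψ : TraceClass (Q.space a)) : Prop :=
  ψ ∈ Q.states a ∧ ψ ∉ Q.freeStates a ∧ Q.rconv ψ ψ = ∞

/-- The distillable resource `R_D`, relative to the normalization `Rmax`. -/
def distillable (Rmax : Q.Sys → ℝ≥0) (ψ : TraceClass (Q.space a)) : ℝ≥0∞ :=
  ⨅ φ ∈ Q.states a, Q.rconv ψ φ * Rmax a

/-- The resource cost `R_C`, relative to the normalization `Rmax`. -/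
def cost (Rmax : Q.Sys → ℝ≥0) (ψ : TraceClass (Q.space a)) : ℝ≥0∞ :=
  ⨅ φ ∈ Q.states a, Rmax a / Q.rconv φ ψ

/-- A resource measure: a real function of states that no free operation increases. -/
def IsResourceMeasure (R : ∀ a, Q.states a → ℝ) : Prop :=
  ∀ (a b : Q.Sys) (ρ : Q.states a) (σ : Q.states b), ∀ N ∈ Q.free a b,
    N (ρ : TraceClass (Q.space a)) = σ → R b σ ≤ R a ρ

/-- Conventional normalization: `0` on free states, `Rmax` on maximally resourceful states. -/
def IsConventionallyNormalized (Rmax : Q.Sys → ℝ≥0) (R : ∀ a, Q.states a → ℝ) : Prop :=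
  ∀ (a : Q.Sys) (ρ : Q.states a), ((ρ : TraceClass (Q.space a)) ∈ Q.freeStates a → R a ρ = 0) ∧
    ((ρ : TraceClass (Q.space a)) ∈ Q.maximal a → R a ρ = Rmax a)

/-- Weak additivity: `R(ρ^{⊗n}) = n R(ρ)` for `n ≥ 1`. -/
def IsWeaklyAdditive (R : ∀ a, Q.states a → ℝ) : Prop :=
  ∀ (a : Q.Sys) (ρ : Q.states a) (n : ℕ) (σ : Q.states (Q.tpow a n)), 1 ≤ n →
    (σ : TraceClass (Q.space (Q.tpow a n))) = Q.spow (ρ : TraceClass (Q.space a)) n →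
    R (Q.tpow a n) σ = n * R a ρ

/-- Strong superadditivity: `R(ρ^A) + R(ρ^B) ≤ R(ρ)` for every state `ρ` of `A ⊗ B`. -/
def IsStronglySuperadditive (R : ∀ a, Q.states a → ℝ) : Prop :=
  ∀ (a b : Q.Sys) (ρ : Q.states (Q.tensor a b)) (σ : Q.states a) (τ : Q.states b),
    Q.IsReduction (ρ : TraceClass (Q.space (Q.tensor a b))) (σ : TraceClass (Q.space a))
      (τ : TraceClass (Q.space b)) → R a σ + R b τ ≤ R (Q.tensor a b) ρ

end QRT

end QResource

end

noncomputable section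

namespace QResource

open scoped InnerProductSpace ComplexOrder

/-! ### Traces and trace-norm estimates for trace-class operators -/

section Trace

variable {H : Type*} [NormedAddCommGroup H] [InnerProductSpace ℂ H] [CompleteSpace H]
variable {K : Type*} [NormedAddCommGroup K] [InnerProductSpace ℂ K] [CompleteSpace K]

/-! Everything reduces to one inequality: if `r` is an achievable rate from `φ` to `ψ`, then `r R(ψ)
≤ R(φ)` (`rate_mul_measure_le`). Fix `0 < c < R(ψ)`. Lower semi-continuity gives an `ε`-ball around
`ψ` on which `R ≥ c`. For some `n ≥ 1` the output of the free operation is `ε`-close to the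
`⌈rn⌉`-fold power of `ψ`. Partial traces do not increase the trace norm, so every one-copy marginal
of the output lies in that ball, and strong superadditivity, applied by induction on the number of
copies, gives `R ≥ ⌈rn⌉ c` for the output (`mul_le_measure_of_norm_sub_spow_lt`). Monotonicity and
weak additivity of the source bound this by `n R(φ)`. Dividing by `n` and letting `c` tend to `R(ψ)`
gives the claim. Only one good `n` is needed, which is why a vanishing liminf suffices.

For the bound on the distillable resource, the target is a maximally resourceful state, where `R`
equals the normalization constant. For the bound on the cost, `R(φ)` is at most that constant
because every state lies below a maximally resourceful one. Both uses rest on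
`exists_maximal_converts`, a Zorn argument whose chains are bounded by compactness of the states and
of the free operations. Nonnegativity of `R` holds because discarding a system is free.

Arbitrary dimension makes the partial trace the main analytic burden. It has to be a channel,
contract the trace norm, represent the reductions, and send allowed states to allowed states. This
rests on the trace being independent of the basis, which follows by writing a trace-class operator
as a product of two Hilbert-Schmidt operators. -/

/-- Taking adjoints moves `A` to the outside, where its norm bounds each term separately. -/
theorem hs_comp_right_le {ι : Type*} (b : HilbertBasis ι ℂ H) (T : H →L[ℂ] K) (A : H →L[ℂ] H) :
    ∑' i, ‖T (A (b i))‖ₑ ^ 2 ≤ ‖A‖ₑ ^ 2 * ∑' i, ‖T (b i)‖ₑ ^ 2 := by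
  have h := hs_adjoint b (stdBasis K) (T ∘L A)
  simp only [ContinuousLinearMap.comp_apply, ContinuousLinearMap.adjoint_comp] at h
  rw [h, hs_adjoint b (stdBasis K) T, ← ENNReal.tsum_mul_left]
  refine ENNReal.tsum_le_tsum fun i => ?_
  rw [← mul_pow]
  gcongr
  have := (ContinuousLinearMap.adjoint A).le_opENorm
    (ContinuousLinearMap.adjoint T (stdBasis K i))
  refine this.trans_eq ?_
  congr 1
  rw [← ofReal_norm, ← ofReal_norm, LinearIsometryEquiv.norm_map]

theorem hasSum_norm_sq_of_hs {ι : Type*} (b : HilbertBasis ι ℂ H) (F : H →L[ℂ] K)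
    (hF : ∑' i, ‖F (stdBasis H i)‖ₑ ^ 2 ≠ ∞) :
    HasSum (fun i => ‖F (b i)‖ ^ 2) (∑' i, ‖F (stdBasis H i)‖ₑ ^ 2).toReal := by
  rw [hs_basis (stdBasis H) b] at hF ⊢
  have h := ENNReal.hasSum_toReal hF
  rw [ENNReal.tsum_toReal_eq (fun i => ENNReal.ne_top_of_tsum_ne_top hF i)]
  simpa using h

theorem hs_add {ι : Type*} (b : HilbertBasis ι ℂ H) (F G : H →L[ℂ] K)
    (hF : ∑' i, ‖F (b i)‖ₑ ^ 2 ≠ ∞) (hG : ∑' i, ‖G (b i)‖ₑ ^ 2 ≠ ∞) :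
    ∑' i, ‖(F + G) (b i)‖ₑ ^ 2 ≠ ∞ := by
  have hle : ∑' i, ‖(F + G) (b i)‖ₑ ^ 2 ≤
      ∑' i, (2 * ‖F (b i)‖ₑ ^ 2 + 2 * ‖G (b i)‖ₑ ^ 2) := by
    refine ENNReal.tsum_le_tsum fun i => ?_
    have h1 : ‖(F + G) (b i)‖ ^ 2 ≤ 2 * ‖F (b i)‖ ^ 2 + 2 * ‖G (b i)‖ ^ 2 := by
      have := norm_add_le (F (b i)) (G (b i))
      rw [add_apply]
      nlinarith [norm_nonneg (F (b i) + G (b i)), sq_nonneg (‖F (b i)‖ - ‖G (b i)‖)]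
    have h2 := ENNReal.ofReal_le_ofReal h1
    rwa [ENNReal.ofReal_add (by positivity) (by positivity), ENNReal.ofReal_mul (by positivity),
      ENNReal.ofReal_mul (by positivity), ENNReal.ofReal_pow (norm_nonneg _),
      ENNReal.ofReal_pow (norm_nonneg _), ENNReal.ofReal_pow (norm_nonneg _), ofReal_norm,
      ofReal_norm, ofReal_norm, ENNReal.ofReal_ofNat] at h2
  refine ne_top_of_le_ne_top ?_ hle
  rw [ENNReal.tsum_add, ENNReal.tsum_mul_left, ENNReal.tsum_mul_left]
  exact ENNReal.add_ne_top.mpr ⟨ENNReal.mul_ne_top (by simp) hF, ENNReal.mul_ne_top (by simp) hG⟩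

theorem hs_smul {ι : Type*} (b : HilbertBasis ι ℂ H) (c : ℂ) (F : H →L[ℂ] K)
    (hF : ∑' i, ‖F (b i)‖ₑ ^ 2 ≠ ∞) : ∑' i, ‖(c • F) (b i)‖ₑ ^ 2 ≠ ∞ := by
  simp only [smul_apply, enorm_smul, mul_pow]
  rw [ENNReal.tsum_mul_left]
  exact ENNReal.mul_ne_top (by simp) hF

/-- The Hilbert-Schmidt inner product of two operators, through polarization. -/
def hsInner (F G : H →L[ℂ] K) : ℂ :=
  let z : ℂ → ℂ := fun c => ((∑' i, ‖(F + c • G) (stdBasis H i)‖ₑ ^ 2).toReal : ℂ)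
  (z 1 - z (-1) + (z (-Complex.I) - z Complex.I) * Complex.I) / 4

/-- The Hilbert-Schmidt inner product does not depend on the basis. -/
theorem hasSum_hsInner {ι : Type*} (b : HilbertBasis ι ℂ H) (F G : H →L[ℂ] K)
    (hF : ∑' i, ‖F (stdBasis H i)‖ₑ ^ 2 ≠ ∞) (hG : ∑' i, ‖G (stdBasis H i)‖ₑ ^ 2 ≠ ∞) :
    HasSum (fun i => ⟪F (b i), G (b i)⟫_ℂ) (hsInner F G) := by
  have key : ∀ c : ℂ, HasSum (fun i => (((‖(F + c • G) (b i)‖ ^ 2 : ℝ)) : ℂ))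
      ((∑' i, ‖(F + c • G) (stdBasis H i)‖ₑ ^ 2).toReal : ℂ) := fun c =>
    Complex.hasSum_ofReal.mpr
      (hasSum_norm_sq_of_hs b _ (hs_add _ F (c • G) hF (hs_smul _ c G hG)))
  refine ((((key 1).sub (key (-1))).add
    (((key (-Complex.I)).sub (key Complex.I)).mul_right Complex.I)).div_const 4).congr_fun ?_
  intro i
  rw [inner_eq_sum_norm_sq_div_four]
  simp [sub_eq_add_neg]

/-- A trace-class operator is a product of two Hilbert-Schmidt operators. -/
theorem exists_hs_factorization (T : H →L[ℂ] H) :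
    ∃ F G : H →L[ℂ] H, (∀ x y, ⟪x, T y⟫_ℂ = ⟪F x, G y⟫_ℂ) ∧
      (∑' i, ‖F (stdBasis H i)‖ₑ ^ 2 ≤ eTraceNorm T) ∧
      (∑' i, ‖G (stdBasis H i)‖ₑ ^ 2 ≤ eTraceNorm T) := by
  obtain ⟨U, hU, hUT, -⟩ := exists_polar T
  set Q := CFC.sqrt (CFC.abs T) with hQ
  have hQs : ContinuousLinearMap.adjoint Q = Q :=
    (CFC.sqrt_nonneg (CFC.abs T)).isSelfAdjoint.adjoint_eq
  have hQQ : ∀ x, Q (Q x) = CFC.abs T x := fun x =>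
    congrArg (fun S : H →L[ℂ] H => S x) (CFC.sqrt_mul_sqrt_self (CFC.abs T) (CFC.abs_nonneg T))
  -- With the polar form `T = U|T|` and `Q = √|T|`, one has `T = (Q U†)† Q`.
  refine ⟨Q ∘L ContinuousLinearMap.adjoint U, Q, fun x y => ?_, ?_, ?_⟩
  · rw [← hUT, ← hQQ, ContinuousLinearMap.comp_apply, ← ContinuousLinearMap.adjoint_inner_right Q,
      hQs, ContinuousLinearMap.adjoint_inner_left]
  · rw [eTraceNorm_eq (stdBasis H)]
    exact hs_comp_le' _ _ _ (by simpa using hU)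
  · rw [eTraceNorm_eq (stdBasis H)]

/-- `∑ |⟨k|T X|k⟩| ≤ ‖T‖₁` for a contraction `X`. -/
theorem tsum_inner_right_le {ι : Type*} (b : HilbertBasis ι ℂ H) (T X : H →L[ℂ] H)
    (hX : ‖X‖ ≤ 1) : ∑' i, ‖⟪b i, T (X (b i))⟫_ℂ‖ₑ ≤ eTraceNorm T := by
  obtain ⟨F, G, h, hF, hG⟩ := exists_hs_factorization T
  rw [hs_basis _ b] at hF hG
  have key : ∀ i, ‖⟪b i, T (X (b i))⟫_ℂ‖ₑ ≤
      (1 / 2) * ‖F (b i)‖ₑ ^ 2 + (1 / 2) * ‖G (X (b i))‖ₑ ^ 2 := by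
    intro i
    have h2 : ‖⟪b i, T (X (b i))⟫_ℂ‖ ≤
        (1 / 2) * ‖F (b i)‖ ^ 2 + (1 / 2) * ‖G (X (b i))‖ ^ 2 := by
      rw [h]
      refine (norm_inner_le_norm _ _).trans ?_
      nlinarith [sq_nonneg (‖F (b i)‖ - ‖G (X (b i))‖)]
    have h3 := ENNReal.ofReal_le_ofReal h2
    rw [ENNReal.ofReal_add (by positivity) (by positivity), ENNReal.ofReal_mul (by positivity),
      ENNReal.ofReal_mul (by positivity), ENNReal.ofReal_pow (norm_nonneg _),
      ENNReal.ofReal_pow (norm_nonneg _), ofReal_norm, ofReal_norm, ofReal_norm] at h3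
    have h4 : ENNReal.ofReal (1 / 2) = 1 / 2 := by
      rw [ENNReal.ofReal_div_of_pos two_pos]; simp
    rwa [h4] at h3
  refine (ENNReal.tsum_le_tsum key).trans ?_
  rw [ENNReal.tsum_add, ENNReal.tsum_mul_left, ENNReal.tsum_mul_left]
  calc _ ≤ (1 / 2) * eTraceNorm T + (1 / 2) * eTraceNorm T := by
        gcongr
        exact (hs_comp_le' b G X hX).trans hG
    _ = eTraceNorm T := by rw [← add_mul, ENNReal.add_halves, one_mul]

namespace TraceClass

/-- The trace of `T X` is the sum over any orthonormal basis. -/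
theorem hasSum_opTrace (T : TraceClass H) (X : H →L[ℂ] H) {ι : Type*} (b : HilbertBasis ι ℂ H) :
    HasSum (fun i => ⟪b i, T.op (X (b i))⟫_ℂ) (opTrace (T.op * X)) := by
  obtain ⟨F, G, h, hF, hG⟩ := exists_hs_factorization T.op
  -- Absorbing `X` into the right factor keeps it Hilbert-Schmidt, so the trace of `T X` is a
  -- Hilbert-Schmidt inner product and inherits its basis independence.
  have hG' : ∑' i, ‖(G ∘L X) (stdBasis H i)‖ₑ ^ 2 ≠ ∞ :=
    ne_top_of_le_ne_top (ENNReal.mul_ne_top (by simp) (ne_top_of_le_ne_top T.finite.ne hG))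
      (hs_comp_right_le _ G X)
  have hF' := ne_top_of_le_ne_top T.finite.ne hF
  have hs : opTrace (T.op * X) = hsInner F (G ∘L X) :=
    ((hasSum_hsInner (stdBasis H) F _ hF' hG').congr_fun fun i => h _ _).tsum_eq
  rw [hs]
  exact (hasSum_hsInner b F _ hF' hG').congr_fun fun i => h _ _

theorem hasSum_opTrace_op (T : TraceClass H) {ι : Type*} (b : HilbertBasis ι ℂ H) :
    HasSum (fun i => ⟪b i, T.op (b i)⟫_ℂ) (opTrace T.op) := by
  simpa using T.hasSum_opTrace 1 b

theorem opTrace_add_mul (S T : TraceClass H) (X : H →L[ℂ] H) :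
    opTrace ((S + T).op * X) = opTrace (S.op * X) + opTrace (T.op * X) := by
  refine HasSum.tsum_eq ((S.hasSum_opTrace X (stdBasis H)).add (T.hasSum_opTrace X (stdBasis H)) |>.congr_fun fun i => ?_)
  rw [← inner_add_right]
  rfl

theorem opTrace_smul_mul (c : ℂ) (T : TraceClass H) (X : H →L[ℂ] H) :
    opTrace ((c • T).op * X) = c * opTrace (T.op * X) := by
  refine HasSum.tsum_eq ((T.hasSum_opTrace X (stdBasis H)).mul_left c |>.congr_fun fun i => ?_)
  rw [← inner_smul_right]
  rfl

theorem opTrace_mul_add (T : TraceClass H) (X Y : H →L[ℂ] H) :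
    opTrace (T.op * (X + Y)) = opTrace (T.op * X) + opTrace (T.op * Y) := by
  refine HasSum.tsum_eq ((T.hasSum_opTrace X (stdBasis H)).add (T.hasSum_opTrace Y (stdBasis H)) |>.congr_fun fun i => ?_)
  rw [← inner_add_right, ← map_add]
  rfl

theorem opTrace_mul_smul (c : ℂ) (T : TraceClass H) (X : H →L[ℂ] H) :
    opTrace (T.op * (c • X)) = c * opTrace (T.op * X) := by
  refine HasSum.tsum_eq ((T.hasSum_opTrace X (stdBasis H)).mul_left c |>.congr_fun fun i => ?_)
  rw [← inner_smul_right, ← map_smul]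
  rfl

theorem opTrace_op_add (S T : TraceClass H) :
    opTrace (S + T).op = opTrace S.op + opTrace T.op := by
  simpa using opTrace_add_mul S T 1

/-- Rank-one test operators recover matrix elements, so the functionals `X ↦ tr[T X]` separate
trace-class operators. -/
theorem opTrace_mul_rankOne (T : TraceClass H) (x y : H) :
    opTrace (T.op * InnerProductSpace.rankOne ℂ y x) = ⟪x, T.op y⟫_ℂ := by
  refine HasSum.tsum_eq (((stdBasis H).hasSum_inner_mul_inner x (T.op y)).congr_fun fun i => ?_)
  rw [← inner_smul_right, ← map_smul]
  rfl

theorem ext_opTrace {S T : TraceClass H}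
    (h : ∀ X, opTrace (S.op * X) = opTrace (T.op * X)) : S = T := by
  refine TraceClass.ext (ContinuousLinearMap.ext fun y => ext_inner_left ℂ fun x => ?_)
  rw [← opTrace_mul_rankOne, ← opTrace_mul_rankOne, h]

theorem norm_opTrace_mul_le (T : TraceClass H) (X : H →L[ℂ] H) :
    ‖opTrace (T.op * X)‖ ≤ ‖T‖ * ‖X‖ := by
  have h1 : ∀ Y : H →L[ℂ] H, ‖Y‖ ≤ 1 → ‖opTrace (T.op * Y)‖ ≤ ‖T‖ := by
    intro Y hY
    have h := enorm_tsum_le_tsum_enorm.trans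
      (tsum_inner_right_le (stdBasis H) T.op Y hY)
    have h' := ENNReal.toReal_mono T.finite.ne h
    rwa [toReal_enorm] at h'
  rcases eq_or_ne X 0 with rfl | hX
  · simp [opTrace]
  · have hn : ‖X‖ ≠ 0 := norm_ne_zero_iff.mpr hX
    -- Rescaling reduces to a contraction, for which the diagonal sums are dominated by the trace
    -- norm.
    have h2 := h1 (((‖X‖⁻¹ : ℝ) : ℂ) • X) (by
      rw [norm_smul, Complex.norm_real, norm_inv, norm_norm, inv_mul_cancel₀ hn])
    rw [opTrace_mul_smul, norm_mul, Complex.norm_real, norm_inv, norm_norm] at h2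
    rwa [inv_mul_le_iff₀ (norm_pos_iff.mpr hX), mul_comm] at h2

theorem norm_eq_re_opTrace (T : TraceClass H) (hT : 0 ≤ T.op) : ‖T‖ = (opTrace T.op).re := by
  have h := Complex.hasSum_re (T.hasSum_opTrace_op (stdBasis H))
  have hpos : ∀ i, 0 ≤ (⟪stdBasis H i, T.op (stdBasis H i)⟫_ℂ).re := fun i =>
    (Complex.le_def.mp (((ContinuousLinearMap.nonneg_iff_isPositive _).mp hT).inner_nonneg_right
      (stdBasis H i))).1
  rw [norm_def, eTraceNorm, CFC.abs_of_nonneg T.op hT,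
    ← ENNReal.ofReal_tsum_of_nonneg hpos h.summable, h.tsum_eq,
    ENNReal.toReal_ofReal (h.nonneg hpos)]

end TraceClass

theorem eTraceNorm_mono {P T : H →L[ℂ] H} (hP : 0 ≤ P) (hPT : P ≤ CFC.abs T) :
    eTraceNorm P ≤ eTraceNorm T := by
  rw [eTraceNorm, eTraceNorm, CFC.abs_of_nonneg P hP]
  refine ENNReal.tsum_le_tsum fun i => ENNReal.ofReal_le_ofReal ?_
  have h := (Complex.le_def.mp (((ContinuousLinearMap.nonneg_iff_isPositive _).mp
    (sub_nonneg.mpr hPT)).inner_nonneg_right (stdBasis H i))).1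
  rw [sub_apply, inner_sub_right, Complex.sub_re, Complex.zero_re] at h
  linarith

namespace TraceClass

/-- A self-adjoint trace-class operator is a difference of positive ones. -/
theorem exists_posPart_sub_negPart (T : TraceClass H) (hT : IsSelfAdjoint T.op) :
    ∃ P N : TraceClass H, 0 ≤ P.op ∧ 0 ≤ N.op ∧ T = P - N ∧ ‖T‖ = ‖P‖ + ‖N‖ := by
  have hp := CFC.posPart_nonneg T.op
  have hn := CFC.negPart_nonneg T.op
  have habs := CFC.posPart_add_negPart T.op hT
  let P : TraceClass H := .ofOp T.op⁺ ((eTraceNorm_mono hp (by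
    rw [← habs]; exact le_add_of_nonneg_right hn)).trans_lt T.finite)
  let N : TraceClass H := .ofOp T.op⁻ ((eTraceNorm_mono hn (by
    rw [← habs]; exact le_add_of_nonneg_left hp)).trans_lt T.finite)
  -- `P + N` is `|T|`; on positive operators the trace norm is the trace, hence additive.
  have hsum : ‖T‖ = ‖P + N‖ := by
    rw [norm_def, norm_def, op_add]
    change _ = (eTraceNorm (T.op⁺ + T.op⁻)).toReal
    rw [habs, eTraceNorm, eTraceNorm, CFC.abs_of_nonneg _ (CFC.abs_nonneg T.op)]
  refine ⟨P, N, hp, hn, ?_, ?_⟩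
  · rw [eq_sub_iff_add_eq]
    refine TraceClass.ext ?_
    rw [op_add]
    change T.op + T.op⁻ = T.op⁺
    rw [← eq_sub_iff_add_eq, CFC.posPart_sub_negPart T.op hT]
  · rw [hsum, norm_eq_re_opTrace _ (add_nonneg hp hn), norm_eq_re_opTrace P hp,
      norm_eq_re_opTrace N hn, opTrace_op_add, Complex.add_re]

end TraceClass

/-- This is complete positivity for a single block, `n = 1`. -/
theorem Channel.map_nonneg (Φ : Channel H K) (T : TraceClass H) (hT : 0 ≤ T.op) :
    0 ≤ (Φ T).op := by
  have h : BlockPositive fun _ _ : Fin 1 => T := by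
    intro v
    simpa using ((ContinuousLinearMap.nonneg_iff_isPositive _).mp hT).inner_nonneg_right (v 0)
  have h2 := Φ.completelyPositive 1 _ h
  rw [ContinuousLinearMap.nonneg_iff_isPositive]
  refine (ContinuousLinearMap.isPositive_iff_complex _).mpr fun x => ?_
  have h3 : 0 ≤ ⟪x, (Φ T).op x⟫_ℂ := by simpa using h2 fun _ => x
  have h4 : 0 ≤ ⟪(Φ T).op x, x⟫_ℂ := by
    rw [← inner_conj_symm, starRingEnd_apply, star_nonneg_iff]
    exact h3
  rw [Complex.le_def] at h4
  exact ⟨Complex.ext rfl h4.2, h4.1⟩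

/-- Channels do not increase the trace norm of self-adjoint operators. -/
theorem Channel.norm_map_le (Φ : Channel H K) (T : TraceClass H) (hT : IsSelfAdjoint T.op) :
    ‖Φ T‖ ≤ ‖T‖ := by
  obtain ⟨P, N, hP, hN, rfl, h⟩ := T.exists_posPart_sub_negPart hT
  -- On positive operators the trace norm is the trace, which `Φ` preserves; the Jordan
  -- decomposition and the triangle inequality do the rest.
  have key : ∀ S : TraceClass H, 0 ≤ S.op → ‖Φ S‖ = ‖S‖ := fun S hS => by
    rw [TraceClass.norm_eq_re_opTrace _ (Φ.map_nonneg S hS), Φ.tracePreserving,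
      TraceClass.norm_eq_re_opTrace S hS]
  rw [h, ← key P hP, ← key N hN, map_sub]
  exact norm_sub_le _ _

end Trace

/-! ### Partial traces as channels -/

section PartialTrace

variable {A : Type*} [NormedAddCommGroup A] [InnerProductSpace ℂ A] [CompleteSpace A]
variable {K : Type*} [NormedAddCommGroup K] [InnerProductSpace ℂ K] [CompleteSpace K]

variable (A K) in
/-- A realization of `K` as a composite of `A` with another system: copies `V j : A → K` of `A`
that together carry an orthonormal basis, and the action `π` of `B(A)` on all copies. -/
structure Ampliation (ι J : Type*) where
  /-- The embedded copies of `A`. -/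
  V : J → A →L[ℂ] K
  /-- The representation `X ↦ X ⊗ 1`. -/
  π : (A →L[ℂ] A) → (K →L[ℂ] K)
  /-- A basis of `A`. -/
  basis : HilbertBasis ι ℂ A
  /-- The corresponding basis of `K`. -/
  total : HilbertBasis (ι × J) ℂ K
  total_apply : ∀ p, total p = V p.2 (basis p.1)
  π_V : ∀ X j x, π X (V j x) = V j (X x)
  norm_π_le : ∀ X, ‖π X‖ ≤ ‖X‖

theorem _root_.HilbertBasis.clm_ext {ι : Type*} (b : HilbertBasis ι ℂ K) {S T : K →L[ℂ] A}
    (h : ∀ i, S (b i) = T (b i)) : S = T :=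
  ContinuousLinearMap.ext_on (s := Set.range b)
    (Submodule.dense_iff_topologicalClosure_eq_top.mpr b.dense_span) (by
      rintro _ ⟨i, rfl⟩
      exact h i)

namespace Ampliation

variable {ι J : Type*} (P : Ampliation A K ι J)

theorem π_total (X : A →L[ℂ] A) (p : ι × J) : P.π X (P.total p) = P.V p.2 (X (P.basis p.1)) := by
  rw [P.total_apply, P.π_V]

/-- Linearity of `π` need not be assumed: `π_V` fixes `π X` on the orthonormal basis `total`. -/
theorem π_add (X Y : A →L[ℂ] A) : P.π (X + Y) = P.π X + P.π Y :=
  P.total.clm_ext fun p => by simp [π_total]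

theorem π_smul (c : ℂ) (X : A →L[ℂ] A) : P.π (c • X) = c • P.π X :=
  P.total.clm_ext fun p => by simp [π_total]

theorem π_one : P.π 1 = 1 :=
  P.total.clm_ext fun p => by rw [π_total, P.total_apply]; rfl

/-- The sesquilinear form `(x, y) ↦ tr[T (|y⟩⟨x| ⊗ 1)]` of the partial trace. -/
def form (T : TraceClass K) : A →L⋆[ℂ] A →L[ℂ] ℂ :=
  LinearMap.mkContinuous₂
    (LinearMap.mk₂'ₛₗ (starRingEnd ℂ) (RingHom.id ℂ)
      (fun x y => opTrace (T.op * P.π (InnerProductSpace.rankOne ℂ y x)))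
      (fun x x' y => by rw [map_add, π_add, TraceClass.opTrace_mul_add])
      (fun c x y => by
        rw [map_smulₛₗ, π_smul, TraceClass.opTrace_mul_smul, smul_eq_mul])
      (fun x y y' => by
        rw [map_add, add_apply, π_add, TraceClass.opTrace_mul_add])
      (fun c x y => by
        rw [map_smul, smul_apply, π_smul, TraceClass.opTrace_mul_smul]
        rfl))
    ‖T‖ (fun x y => by
      refine (T.norm_opTrace_mul_le _).trans ?_
      rw [mul_assoc]
      gcongr
      refine (P.norm_π_le _).trans ?_
      rw [InnerProductSpace.norm_rankOne, mul_comm])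

/-- The partial trace as a bounded operator. -/
def ptraceOp (T : TraceClass K) : A →L[ℂ] A :=
  ContinuousLinearMap.adjoint (InnerProductSpace.continuousLinearMapOfBilin (P.form T))

theorem inner_ptraceOp (T : TraceClass K) (x y : A) :
    ⟪x, P.ptraceOp T y⟫_ℂ = opTrace (T.op * P.π (InnerProductSpace.rankOne ℂ y x)) := by
  rw [ptraceOp, ContinuousLinearMap.adjoint_inner_right,
    InnerProductSpace.continuousLinearMapOfBilin_apply]
  rfl

/-- The partial trace is `∑ⱼ Vⱼ† T Vⱼ` in the weak sense. This Kraus form yields complete positivity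
and the evaluation on product operators. -/
theorem hasSum_inner_ptraceOp (T : TraceClass K) (x y : A) :
    HasSum (fun j => ⟪P.V j x, T.op (P.V j y)⟫_ℂ) ⟪x, P.ptraceOp T y⟫_ℂ := by
  rw [inner_ptraceOp]
  have h := T.hasSum_opTrace (P.π (InnerProductSpace.rankOne ℂ y x)) P.total
  rw [← (Equiv.prodComm J ι).hasSum_iff] at h
  refine h.prod_fiberwise fun j => ?_
  -- For fixed `j`, Parseval in `A` collapses the sum over `i` to one matrix element of `Vⱼ† T Vⱼ`.
  have h2 := P.basis.hasSum_inner_mul_inner x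
    (ContinuousLinearMap.adjoint (P.V j) (T.op (P.V j y)))
  rw [ContinuousLinearMap.adjoint_inner_right] at h2
  refine h2.congr_fun fun i => ?_
  simp only [Function.comp_apply, Equiv.prodComm_apply, Prod.swap_prod_mk, P.π_V,
    InnerProductSpace.rankOne_apply, P.total_apply, map_smul, inner_smul_right,
    ContinuousLinearMap.adjoint_inner_right]

/-- By duality: a contraction `U` with `|ptrace T| = U† ptrace T` lifts to the contraction `π U` on
`K`, and `tr |ptrace T|` becomes a diagonal sum of `(π U)† T`, which is at most the trace norm of
`T`. -/
theorem eTraceNorm_ptraceOp_le (T : TraceClass K) : eTraceNorm (P.ptraceOp T) ≤ eTraceNorm T.op := by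
  obtain ⟨U, hU, -, hUT⟩ := exists_polar (P.ptraceOp T)
  have hL : ‖ContinuousLinearMap.adjoint (P.π U)‖ ≤ 1 := by
    rw [LinearIsometryEquiv.norm_map]
    exact (P.norm_π_le U).trans hU
  refine le_trans ?_ (tsum_inner_le P.total T.op _ hL)
  rw [eTraceNorm_eq_basis P.basis, ENNReal.tsum_prod']
  refine ENNReal.tsum_le_tsum fun i => ?_
  rw [← hUT, ContinuousLinearMap.adjoint_inner_right,
    ← (P.hasSum_inner_ptraceOp T (U (P.basis i)) (P.basis i)).tsum_eq]
  refine (ENNReal.ofReal_le_ofReal (Complex.re_le_norm _)).trans ?_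
  rw [ofReal_norm]
  refine enorm_tsum_le_tsum_enorm.trans (ENNReal.tsum_le_tsum fun j => le_of_eq ?_)
  rw [ContinuousLinearMap.adjoint_inner_right, π_total, P.total_apply]

/-- The partial trace of a trace-class operator. -/
def ptrace (T : TraceClass K) : TraceClass A :=
  .ofOp (P.ptraceOp T) ((P.eTraceNorm_ptraceOp_le T).trans_lt T.finite)

theorem hasSum_inner_ptrace (T : TraceClass K) (x y : A) :
    HasSum (fun j => ⟪P.V j x, T.op (P.V j y)⟫_ℂ) ⟪x, (P.ptrace T).op y⟫_ℂ :=
  P.hasSum_inner_ptraceOp T x y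

theorem norm_ptrace_le (T : TraceClass K) : ‖P.ptrace T‖ ≤ ‖T‖ :=
  ENNReal.toReal_mono T.finite.ne (P.eTraceNorm_ptraceOp_le T)

/-- The defining duality of the partial trace with `X ↦ X ⊗ 1`. It gives linearity, trace
preservation (at `X = 1`) and the reduction property. -/
theorem opTrace_ptrace_mul (T : TraceClass K) (X : A →L[ℂ] A) :
    opTrace ((P.ptrace T).op * X) = opTrace (T.op * P.π X) := by
  have h1 := (P.ptrace T).hasSum_opTrace X P.basis
  refine h1.unique ((T.hasSum_opTrace (P.π X) P.total).prod_fiberwise fun i => ?_)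
  refine (P.hasSum_inner_ptrace T (P.basis i) (X (P.basis i))).congr_fun fun j => ?_
  rw [π_total, P.total_apply]

theorem ptrace_add (S T : TraceClass K) : P.ptrace (S + T) = P.ptrace S + P.ptrace T :=
  TraceClass.ext_opTrace fun X => by
    simp only [opTrace_ptrace_mul, TraceClass.opTrace_add_mul]

theorem ptrace_smul (c : ℂ) (T : TraceClass K) : P.ptrace (c • T) = c • P.ptrace T :=
  TraceClass.ext_opTrace fun X => by
    simp only [opTrace_ptrace_mul, TraceClass.opTrace_smul_mul]

/-- The partial trace as a channel. -/
def channel : Channel K A where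
  toLin :=
    { toFun := P.ptrace
      map_add' := P.ptrace_add
      map_smul' := P.ptrace_smul }
  completelyPositive n T hT := by
    intro v
    -- The block form of the output is a sum over `l` of block forms of `T` at the embedded vectors,
    -- each nonnegative.
    have h : HasSum (fun l => ∑ j, ∑ k, ⟪P.V l (v j), (T j k).op (P.V l (v k))⟫_ℂ)
        (∑ j, ∑ k, ⟪v j, (P.ptrace (T j k)).op (v k)⟫_ℂ) :=
      hasSum_sum fun j _ => hasSum_sum fun k _ => P.hasSum_inner_ptrace (T j k) (v j) (v k)
    exact h.nonneg fun l => hT fun j => P.V l (v j)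
  tracePreserving T := by
    have h := P.opTrace_ptrace_mul T 1
    rwa [π_one, mul_one, mul_one] at h

@[simp] theorem channel_apply (T : TraceClass K) : P.channel T = P.ptrace T := rfl

end Ampliation

/-- Conjugation by a unitary as a channel. -/
def conjChannel (U : A ≃ₗᵢ[ℂ] K) : Channel A K where
  toLin :=
    { toFun := TraceClass.conj U
      map_add' := fun S T => TraceClass.ext (by
        simp [TraceClass.conj, conjOp])
      map_smul' := fun c T => TraceClass.ext (by
        simp [TraceClass.conj, conjOp]) }
  completelyPositive n T hT := by
    intro v
    have h := hT fun j => U.symm (v j)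
    refine h.trans_eq (Finset.sum_congr rfl fun j _ => Finset.sum_congr rfl fun k _ => ?_)
    change _ = ⟪v j, conjOp U (T j k).op (v k)⟫_ℂ
    rw [conjOp_apply, ← U.inner_map_map, U.apply_symm_apply]
  tracePreserving T := by
    let b : HilbertBasis (basisIndex A) ℂ K := .ofRepr (U.symm.trans (stdBasis A).repr)
    have hb : ∀ i, b i = U (stdBasis A i) := by
      intro i
      classical
      rw [← b.repr_symm_single, ← (stdBasis A).repr_symm_single]
      rfl
    refine ((TraceClass.conj U T).hasSum_opTrace_op b).unique
      ((T.hasSum_opTrace_op (stdBasis A)).congr_fun fun i => ?_)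
    change ⟪b i, conjOp U T.op (b i)⟫_ℂ = _
    rw [hb, conjOp_apply, U.symm_apply_apply, U.inner_map_map]

end PartialTrace

/-! ### Composite systems, their reductions, and the unit identifications -/

section Composite

variable {A : Type*} [NormedAddCommGroup A] [InnerProductSpace ℂ A] [CompleteSpace A]
variable {B : Type*} [NormedAddCommGroup B] [InnerProductSpace ℂ B] [CompleteSpace B]

theorem norm_tensorOp_le (S : A →L[ℂ] A) (T : B →L[ℂ] B) : ‖tensorOp S T‖ ≤ ‖S‖ * ‖T‖ := by
  refine ContinuousLinearMap.opNorm_le_bound _ (by positivity) fun z => ?_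
  refine (HTensor.denseRange_incl A B).induction_on z
    (isClosed_le (by fun_prop) (by fun_prop)) fun a => ?_
  rw [tensorOp_incl, LinearIsometry.norm_map, LinearIsometry.norm_map]
  exact norm_map_le S T a

theorem norm_conjOp (U : A ≃ₗᵢ[ℂ] B) (T : A →L[ℂ] A) : ‖conjOp U T‖ = ‖T‖ :=
  StarAlgEquiv.norm_map U.conjStarAlgEquiv T

theorem norm_hmk (x : A) (y : B) : ‖hmk x y‖ = ‖x‖ * ‖y‖ := by
  rw [hmk, LinearIsometry.norm_map, TensorProduct.norm_tmul]

theorem _root_.HilbertBasis.exists_map {ι : Type*} (b : HilbertBasis ι ℂ A) (U : A ≃ₗᵢ[ℂ] B) :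
    ∃ c : HilbertBasis ι ℂ B, ∀ i, c i = U (b i) := by
  refine ⟨.ofRepr (U.symm.trans b.repr), fun i => ?_⟩
  classical
  rw [← HilbertBasis.repr_symm_single, ← b.repr_symm_single]
  rfl

theorem _root_.HilbertBasis.exists_reindex {ι κ : Type*} (b : HilbertBasis ι ℂ A) (e : κ ≃ ι) :
    ∃ c : HilbertBasis κ ℂ A, ∀ i, c i = b (e i) := by
  refine ⟨HilbertBasis.mk (v := fun i => b (e i)) (b.orthonormal.comp e e.injective) ?_,
    fun i => by rw [HilbertBasis.coe_mk]⟩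
  have : Set.range (fun i => b (e i)) = Set.range b := e.surjective.range_comp b
  rw [this, b.dense_span]

/-- The range of an isometry from a complete space is closed, so containing an orthonormal basis
forces it to be everything. -/
theorem _root_.LinearIsometry.surjective_of_basis {ι : Type*} (f : A →ₗᵢ[ℂ] B)
    (b : HilbertBasis ι ℂ B) (h : ∀ i, b i ∈ Set.range f) : Function.Surjective f := by
  have hle : (Submodule.span ℂ (Set.range b)).topologicalClosure ≤ LinearMap.range f.toLinearMap := by
    refine Submodule.topologicalClosure_minimal _ (Submodule.span_le.mpr ?_) ?_
    · rintro _ ⟨i, rfl⟩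
      exact h i
    · exact f.isometry.isClosedEmbedding.isClosed_range
  rw [b.dense_span] at hle
  exact fun y => hle (Submodule.mem_top (x := y))

end Composite

namespace Systems

variable (Q : Systems.{u, v}) {a b : Q.Sys}

theorem norm_tmul (x : Q.space a) (y : Q.space b) : ‖Q.tmul x y‖ = ‖x‖ * ‖y‖ := by
  rw [tmul, LinearIsometryEquiv.norm_map, norm_hmk]

/-- The map `x ↦ x ⊗ y`. -/
def tmulLeft (a : Q.Sys) (y : Q.space b) : Q.space a →L[ℂ] Q.space (Q.tensor a b) :=
  LinearMap.mkContinuous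
    { toFun := fun x => Q.tmul x y
      map_add' := fun x x' => by simp [tmul, hmk, TensorProduct.add_tmul]
      map_smul' := fun c x => by simp [tmul, hmk, ← TensorProduct.smul_tmul'] }
    ‖y‖ fun x => by
      change ‖Q.tmul x y‖ ≤ _
      rw [norm_tmul, mul_comm]

/-- The map `y ↦ x ⊗ y`. -/
def tmulRight (b : Q.Sys) (x : Q.space a) : Q.space b →L[ℂ] Q.space (Q.tensor a b) :=
  LinearMap.mkContinuous
    { toFun := fun y => Q.tmul x y
      map_add' := fun y y' => by simp [tmul, hmk, TensorProduct.tmul_add]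
      map_smul' := fun c y => by simp [tmul, hmk] }
    ‖x‖ fun y => by
      change ‖Q.tmul x y‖ ≤ _
      rw [norm_tmul]

theorem tmulLeft_apply (x : Q.space a) (y : Q.space b) : Q.tmulLeft a y x = Q.tmul x y := rfl

theorem tmulRight_apply (x : Q.space a) (y : Q.space b) : Q.tmulRight b x y = Q.tmul x y := rfl

theorem smul_tmul (c : ℂ) (x : Q.space a) (y : Q.space b) :
    Q.tmul (c • x) y = Q.tmul x (c • y) := by
  rw [← tmulLeft_apply, ← tmulRight_apply, map_smul, map_smul]
  rfl

theorem top_tmul (X : Q.space a →L[ℂ] Q.space a) (Y : Q.space b →L[ℂ] Q.space b)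
    (x : Q.space a) (y : Q.space b) : Q.top X Y (Q.tmul x y) = Q.tmul (X x) (Y y) := by
  simp [top, tmul]

theorem norm_top_le (X : Q.space a →L[ℂ] Q.space a) (Y : Q.space b →L[ℂ] Q.space b) :
    ‖Q.top X Y‖ ≤ ‖X‖ * ‖Y‖ := by
  rw [top, norm_conjOp]
  exact norm_tensorOp_le X Y

theorem tens_op (S : TraceClass (Q.space a)) (T : TraceClass (Q.space b)) :
    (Q.tens S T).op = Q.top S.op T.op := rfl

theorem inner_tmul (x x' : Q.space a) (y y' : Q.space b) :
    ⟪Q.tmul x y, Q.tmul x' y'⟫_ℂ = ⟪x, x'⟫_ℂ * ⟪y, y'⟫_ℂ := by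
  rw [tmul, tmul, LinearIsometryEquiv.inner_map_map, inner_hmk]

theorem exists_tmulBasis {ι κ : Type*} (b₁ : HilbertBasis ι ℂ (Q.space a))
    (b₂ : HilbertBasis κ ℂ (Q.space b)) :
    ∃ e : HilbertBasis (ι × κ) ℂ (Q.space (Q.tensor a b)),
      ∀ p, e p = Q.tmul (b₁ p.1) (b₂ p.2) := by
  obtain ⟨e, he⟩ := exists_productBasis b₁ b₂
  obtain ⟨c, hc⟩ := e.exists_map (Q.tensorIso a b).symm
  exact ⟨c, fun p => by rw [hc, he]; rfl⟩

/-- `A ⊗ B` as an ampliation of `A`. -/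
def ampLeft (a b : Q.Sys) : Ampliation (Q.space a) (Q.space (Q.tensor a b))
    (basisIndex (Q.space a)) (basisIndex (Q.space b)) where
  V j := Q.tmulLeft a (stdBasis _ j)
  π X := Q.top X 1
  basis := stdBasis _
  total := (Q.exists_tmulBasis (stdBasis _) (stdBasis _)).choose
  total_apply := (Q.exists_tmulBasis (stdBasis _) (stdBasis _)).choose_spec
  π_V X _ x := Q.top_tmul X 1 x _
  norm_π_le X := (Q.norm_top_le X 1).trans
    (mul_le_of_le_one_right (norm_nonneg _) ContinuousLinearMap.norm_id_le)

/-- `Ampliation` lists the index of the retained factor first, so retaining `B` requires the swapped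
product basis. -/
theorem exists_tmulBasis_swap (a b : Q.Sys) :
    ∃ e : HilbertBasis (basisIndex (Q.space b) × basisIndex (Q.space a)) ℂ
      (Q.space (Q.tensor a b)), ∀ p, e p = Q.tmulRight b (stdBasis _ p.2) (stdBasis _ p.1) := by
  obtain ⟨e, he⟩ := Q.exists_tmulBasis (stdBasis (Q.space a)) (stdBasis (Q.space b))
  obtain ⟨c, hc⟩ := e.exists_reindex (Equiv.prodComm _ _)
  exact ⟨c, fun p => by rw [hc, he]; rfl⟩

/-- `A ⊗ B` as an ampliation of `B`. -/
def ampRight (a b : Q.Sys) : Ampliation (Q.space b) (Q.space (Q.tensor a b))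
    (basisIndex (Q.space b)) (basisIndex (Q.space a)) where
  V j := Q.tmulRight b (stdBasis _ j)
  π X := Q.top 1 X
  basis := stdBasis _
  total := (Q.exists_tmulBasis_swap a b).choose
  total_apply := (Q.exists_tmulBasis_swap a b).choose_spec
  π_V X _ x := Q.top_tmul 1 X _ x
  norm_π_le X := (Q.norm_top_le 1 X).trans
    (mul_le_of_le_one_left (norm_nonneg _) ContinuousLinearMap.norm_id_le)

theorem exists_unitBasis :
    ∃ c : HilbertBasis Unit ℂ (Q.space Q.unit), ∀ i, c i = Q.unitIso.symm 1 := by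
  obtain ⟨c, hc⟩ := (OrthonormalBasis.singleton Unit ℂ).toHilbertBasis.exists_map Q.unitIso.symm
  exact ⟨c, fun i => by rw [hc]; simp⟩

theorem exists_unit_total (a : Q.Sys) :
    ∃ e : HilbertBasis (Unit × basisIndex (Q.space a)) ℂ (Q.space a),
      ∀ p, e p = stdBasis _ p.2 :=
  (stdBasis (Q.space a)).exists_reindex (Equiv.punitProd _)

/-- An operator on a one-dimensional space is a scalar. That scalar is what `ampUnit` uses as `X ⊗
1`, so the full trace is a special case of the partial trace. -/
theorem unit_apply (X : Q.space Q.unit →L[ℂ] Q.space Q.unit) (z : Q.space Q.unit) :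
    Q.unitIso (X z) = Q.unitIso (X (Q.unitIso.symm 1)) * Q.unitIso z := by
  have h : z = Q.unitIso z • Q.unitIso.symm 1 := by
    rw [← map_smul, smul_eq_mul, mul_one, Q.unitIso.symm_apply_apply]
  conv_lhs => rw [h, map_smul, map_smul, smul_eq_mul, mul_comm]

/-- Every system as an ampliation of the trivial one. -/
def ampUnit (a : Q.Sys) : Ampliation (Q.space Q.unit) (Q.space a) Unit
    (basisIndex (Q.space a)) where
  V j := (Q.unitIso.toContinuousLinearEquiv : Q.space Q.unit →L[ℂ] ℂ).smulRight (stdBasis _ j)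
  π X := Q.unitIso (X (Q.unitIso.symm 1)) • 1
  basis := Q.exists_unitBasis.choose
  total := (Q.exists_unit_total a).choose
  total_apply p := by
    rw [(Q.exists_unit_total a).choose_spec, Q.exists_unitBasis.choose_spec]
    simp
  π_V X j x := by
    simp [Q.unit_apply X x, mul_smul, smul_comm (Q.unitIso x)]
  norm_π_le X := by
    rw [norm_smul, Q.unitIso.norm_map]
    refine (mul_le_of_le_one_right (norm_nonneg _) ContinuousLinearMap.norm_id_le).trans ?_
    refine (X.le_opNorm _).trans_eq ?_
    rw [Q.unitIso.symm.norm_map, norm_one, mul_one]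

/-- The trace as a channel to the trivial system. -/
def traceChannel (a : Q.Sys) : Channel (Q.space a) (Q.space Q.unit) := (Q.ampUnit a).channel

theorem traceChannel_op (T : TraceClass (Q.space a)) :
    (Q.traceChannel a T).op = opTrace T.op • 1 := by
  refine ContinuousLinearMap.ext fun z => ext_inner_left ℂ fun w => ?_
  refine ((Q.ampUnit a).hasSum_inner_ptrace T w z).unique ?_
  have h := (T.hasSum_opTrace_op (stdBasis _)).mul_right ⟪w, z⟫_ℂ
  simp only [smul_apply, one_apply_eq_self, inner_smul_right]
  refine h.congr_fun fun j => ?_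
  rw [← Q.unitIso.inner_map_map]
  simp only [ampUnit, ContinuousLinearMap.smulRight_apply, map_smul, inner_smul_left,
    inner_smul_right, RCLike.inner_apply, ContinuousLinearEquiv.coe_coe,
    LinearIsometryEquiv.coe_toContinuousLinearEquiv]
  ring

theorem ptrace_ampLeft_tens (S : TraceClass (Q.space a)) (T : TraceClass (Q.space b)) :
    (Q.ampLeft a b).ptrace (Q.tens S T) = opTrace T.op • S := by
  refine TraceClass.ext (ContinuousLinearMap.ext fun y => ext_inner_left ℂ fun x => ?_)
  refine ((Q.ampLeft a b).hasSum_inner_ptrace _ x y).unique ?_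
  rw [TraceClass.op_smul, smul_apply, inner_smul_right]
  refine ((T.hasSum_opTrace_op (stdBasis _)).mul_right ⟪x, S.op y⟫_ℂ).congr_fun fun j => ?_
  simp only [ampLeft, tmulLeft_apply, tens_op, top_tmul, inner_tmul]
  ring

theorem ptrace_ampRight_tens (S : TraceClass (Q.space a)) (T : TraceClass (Q.space b)) :
    (Q.ampRight a b).ptrace (Q.tens S T) = opTrace S.op • T := by
  refine TraceClass.ext (ContinuousLinearMap.ext fun y => ext_inner_left ℂ fun x => ?_)
  refine ((Q.ampRight a b).hasSum_inner_ptrace _ x y).unique ?_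
  rw [TraceClass.op_smul, smul_apply, inner_smul_right]
  refine ((S.hasSum_opTrace_op (stdBasis _)).mul_right ⟪x, T.op y⟫_ℂ).congr_fun fun j => ?_
  simp only [ampRight, tmulRight_apply, tens_op, top_tmul, inner_tmul]

theorem isReduction_ptrace (ρ : TraceClass (Q.space (Q.tensor a b))) :
    Q.IsReduction ρ ((Q.ampLeft a b).ptrace ρ) ((Q.ampRight a b).ptrace ρ) :=
  ⟨fun X => (Q.ampLeft a b).opTrace_ptrace_mul ρ X,
    fun Y => (Q.ampRight a b).opTrace_ptrace_mul ρ Y⟩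

theorem exists_rightUnit (a : Q.Sys) :
    ∃ U : Q.space (Q.tensor a Q.unit) ≃ₗᵢ[ℂ] Q.space a,
      ∀ x z, U (Q.tmul x z) = Q.unitIso z • x := by
  set w := Q.unitIso.symm 1 with hw
  -- Scalars move across the tensor sign, so `x ↦ x ⊗ w` is an isometry that reaches every product
  -- vector; its inverse is the required unitary.
  have hz : ∀ (x : Q.space a) z, Q.tmul x z = Q.tmul (Q.unitIso z • x) w := by
    intro x z
    rw [Q.smul_tmul, hw, ← map_smul, smul_eq_mul, mul_one, Q.unitIso.symm_apply_apply]
  let f : Q.space a →ₗᵢ[ℂ] Q.space (Q.tensor a Q.unit) :=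
    ⟨(Q.tmulLeft a w).toLinearMap, fun x => by
      change ‖Q.tmul x w‖ = _
      rw [norm_tmul, hw, LinearIsometryEquiv.norm_map, norm_one, mul_one]⟩
  obtain ⟨e, he⟩ := Q.exists_tmulBasis (stdBasis (Q.space a)) (stdBasis (Q.space Q.unit))
  let W := LinearIsometryEquiv.ofSurjective f
    (f.surjective_of_basis e fun p => ⟨_, by rw [he, hz]; rfl⟩)
  refine ⟨W.symm, fun x z => ?_⟩
  rw [LinearIsometryEquiv.symm_apply_eq, hz]
  rfl

theorem exists_leftUnit (a : Q.Sys) :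
    ∃ U : Q.space (Q.tensor Q.unit a) ≃ₗᵢ[ℂ] Q.space a,
      ∀ z x, U (Q.tmul z x) = Q.unitIso z • x := by
  set w := Q.unitIso.symm 1 with hw
  have hz : ∀ z (x : Q.space a), Q.tmul z x = Q.tmul w (Q.unitIso z • x) := by
    intro z x
    rw [← Q.smul_tmul, hw, ← map_smul, smul_eq_mul, mul_one, Q.unitIso.symm_apply_apply]
  let f : Q.space a →ₗᵢ[ℂ] Q.space (Q.tensor Q.unit a) :=
    ⟨(Q.tmulRight a w).toLinearMap, fun x => by
      change ‖Q.tmul w x‖ = _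
      rw [norm_tmul, hw, LinearIsometryEquiv.norm_map, norm_one, one_mul]⟩
  obtain ⟨e, he⟩ := Q.exists_tmulBasis (stdBasis (Q.space Q.unit)) (stdBasis (Q.space a))
  let W := LinearIsometryEquiv.ofSurjective f
    (f.surjective_of_basis e fun p => ⟨_, by rw [he, hz]; rfl⟩)
  refine ⟨W.symm, fun z x => ?_⟩
  rw [LinearIsometryEquiv.symm_apply_eq, hz]
  rfl

end Systems

/-! ### Reductions and tensor powers of allowed states -/

namespace QRT

variable (Q : QRT.{u, v}) {a b : Q.Sys}

theorem traceChannel_free (a : Q.Sys) : Q.traceChannel a ∈ Q.free a Q.unit :=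
  Q.free_trace _ fun T => Q.traceChannel_op T

theorem conj_symm_conj {H K : Type*} [NormedAddCommGroup H] [InnerProductSpace ℂ H]
    [CompleteSpace H] [NormedAddCommGroup K] [InnerProductSpace ℂ K] [CompleteSpace K]
    (U : H ≃ₗᵢ[ℂ] K) (T : TraceClass K) : TraceClass.conj U (TraceClass.conj U.symm T) = T :=
  TraceClass.ext (ContinuousLinearMap.ext fun x => by simp [TraceClass.conj])

theorem conj_conj_symm {H K : Type*} [NormedAddCommGroup H] [InnerProductSpace ℂ H]
    [CompleteSpace H] [NormedAddCommGroup K] [InnerProductSpace ℂ K] [CompleteSpace K]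
    (U : H ≃ₗᵢ[ℂ] K) (T : TraceClass H) : TraceClass.conj U.symm (TraceClass.conj U T) = T :=
  TraceClass.ext (ContinuousLinearMap.ext fun x => by simp [TraceClass.conj])

/-- The partial trace is `id ⊗ tr` followed by the identification of `A ⊗ ℂ` with `A`, and both are
free. -/
theorem ptrace_left_mem (ρ : TraceClass (Q.space (Q.tensor a b)))
    (hρ : ρ ∈ Q.states (Q.tensor a b)) : (Q.ampLeft a b).ptrace ρ ∈ Q.states a := by
  obtain ⟨U, hU⟩ := Q.exists_rightUnit a
  -- The channel `id ⊗ tr` is realized as the partial trace followed by `U†`; agreement on product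
  -- operators is all that `free_tensor` asks for.
  have h1 := Q.free_tensor _ (Q.free_id a) _ (Q.traceChannel_free b)
    ((conjChannel U.symm).comp (Q.ampLeft a b).channel) (fun S T => by
      change TraceClass.conj U.symm ((Q.ampLeft a b).ptrace (Q.tens S T)) = Q.tens S _
      rw [Q.ptrace_ampLeft_tens, ← conj_conj_symm U (Q.tens S _)]
      congr 1
      refine TraceClass.ext (ContinuousLinearMap.ext fun x => ?_)
      change _ = conjOp U _ x
      have hx : U.symm x = Q.tmul x (Q.unitIso.symm 1) := by
        rw [LinearIsometryEquiv.symm_apply_eq, hU]; simp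
      rw [conjOp_apply, hx, Q.tens_op, Q.top_tmul, hU, Q.traceChannel_op]
      simp)
  have h2 := Q.free_map _ ((Q.free_rightUnit U hU).1 (conjChannel U) fun T => rfl) _
    (Q.free_map _ h1 ρ hρ)
  have h3 : (conjChannel U) (((conjChannel U.symm).comp (Q.ampLeft a b).channel) ρ) =
    (Q.ampLeft a b).ptrace ρ := conj_symm_conj U _
  rwa [h3] at h2

theorem ptrace_right_mem (ρ : TraceClass (Q.space (Q.tensor a b)))
    (hρ : ρ ∈ Q.states (Q.tensor a b)) : (Q.ampRight a b).ptrace ρ ∈ Q.states b := by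
  obtain ⟨U, hU⟩ := Q.exists_leftUnit b
  have h1 := Q.free_tensor _ (Q.traceChannel_free a) _ (Q.free_id b)
    ((conjChannel U.symm).comp (Q.ampRight a b).channel) (fun S T => by
      change TraceClass.conj U.symm ((Q.ampRight a b).ptrace (Q.tens S T)) = Q.tens _ T
      rw [Q.ptrace_ampRight_tens, ← conj_conj_symm U (Q.tens _ T)]
      congr 1
      refine TraceClass.ext (ContinuousLinearMap.ext fun x => ?_)
      change _ = conjOp U _ x
      have hx : U.symm x = Q.tmul (Q.unitIso.symm 1) x := by
        rw [LinearIsometryEquiv.symm_apply_eq, hU]; simp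
      rw [conjOp_apply, hx, Q.tens_op, Q.top_tmul, hU, Q.traceChannel_op]
      simp)
  have h2 := Q.free_map _ ((Q.free_leftUnit U hU).1 (conjChannel U) fun T => rfl) _
    (Q.free_map _ h1 ρ hρ)
  have h3 : (conjChannel U) (((conjChannel U.symm).comp (Q.ampRight a b).channel) ρ) =
    (Q.ampRight a b).ptrace ρ := conj_symm_conj U _
  rwa [h3] at h2

theorem traceChannel_apply {ρ : TraceClass (Q.space a)} (hρ : ρ ∈ Q.states a) :
    Q.traceChannel a ρ = Q.unitState := by
  refine TraceClass.ext ?_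
  rw [Q.traceChannel_op, (Q.states_subset a hρ).2, one_smul]
  rfl

/-- Sets of allowed states may be empty, so some state is needed whose trace can be taken. -/
theorem unitState_mem {ρ : TraceClass (Q.space a)} (hρ : ρ ∈ Q.states a) :
    Q.unitState ∈ Q.states Q.unit :=
  Q.traceChannel_apply hρ ▸ Q.free_map _ (Q.traceChannel_free a) ρ hρ

theorem spow_mem {ρ : TraceClass (Q.space a)} (hρ : ρ ∈ Q.states a) :
    ∀ n, Q.spow ρ n ∈ Q.states (Q.tpow a n)
  | 0 => Q.unitState_mem hρ
  | n + 1 => Q.states_tensor _ (spow_mem hρ n) _ hρ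

end QRT

/-! ### Joint continuity of the action of channels on states -/

section Evaluation

variable {H K : Type*} [NormedAddCommGroup H] [InnerProductSpace ℂ H] [CompleteSpace H]
  [NormedAddCommGroup K] [InnerProductSpace ℂ K] [CompleteSpace K]

theorem continuous_opTrace_channel (T : TraceClass H) (M : K →L[ℂ] K) :
    Continuous fun Φ : Channel H K => opTrace ((Φ T).op * M) :=
  (continuous_apply (A := fun _ : TraceClass H × (K →L[ℂ] K) => ℂ) (T, M)).comp
    (continuous_induced_dom (f := fun (Φ : Channel H K) (p : TraceClass H × (K →L[ℂ] K)) =>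
      opTrace ((Φ p.1).op * p.2)))

theorem isSelfAdjoint_of_density {ρ : TraceClass H} (hρ : ρ ∈ densityOperators H) :
    IsSelfAdjoint ρ.op := hρ.1.isSelfAdjoint

theorem op_sub (S T : TraceClass H) : (S - T).op = S.op - T.op := rfl

/-- Evaluation `(Φ, ρ) ↦ tr[Φ(ρ) M]` is jointly continuous on density operators. -/
theorem continuous_opTrace_eval {s : Set (TraceClass H)} (hs : s ⊆ densityOperators H)
    (M : K →L[ℂ] K) :
    Continuous fun p : Channel H K × s => opTrace ((p.1 p.2.1).op * M) := by
  rw [continuous_iff_continuousAt]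
  rintro ⟨Φ₀, ρ₀⟩
  have h1 : Filter.Tendsto (fun p : Channel H K × s => opTrace ((p.1 ρ₀.1).op * M))
      (nhds (Φ₀, ρ₀)) (nhds (opTrace ((Φ₀ ρ₀.1).op * M))) :=
    ((continuous_opTrace_channel ρ₀.1 M).comp continuous_fst).tendsto (Φ₀, ρ₀)
  have h2 : Filter.Tendsto (fun p : Channel H K × s => ‖p.2.1 - ρ₀.1‖ * ‖M‖)
      (nhds (Φ₀, ρ₀)) (nhds 0) := by
    have : Continuous fun p : Channel H K × s => ‖p.2.1 - ρ₀.1‖ * ‖M‖ := by fun_prop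
    simpa using this.tendsto (Φ₀, ρ₀)
  -- In `Φ(ρ) = Φ(ρ₀) + Φ(ρ - ρ₀)` the second term is small uniformly in `Φ`, as channels contract
  -- self-adjoint operators; the first is handled by the BW topology.
  have h3 : Filter.Tendsto (fun p : Channel H K × s => opTrace ((p.1 (p.2.1 - ρ₀.1)).op * M))
      (nhds (Φ₀, ρ₀)) (nhds 0) := by
    refine squeeze_zero_norm (fun p => ?_) h2
    refine (TraceClass.norm_opTrace_mul_le _ M).trans ?_
    gcongr
    refine p.1.norm_map_le _ ?_
    rw [op_sub]
    exact (isSelfAdjoint_of_density (hs p.2.2)).sub (isSelfAdjoint_of_density (hs ρ₀.2))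
  have h4 := h1.add h3
  rw [add_zero] at h4
  refine h4.congr fun p => ?_
  rw [← TraceClass.opTrace_add_mul, ← map_add, add_sub_cancel]

end Evaluation

/-! ### Compactness and the existence of maximally resourceful states -/

namespace QRT

variable (Q : QRT.{u, v}) {a b : Q.Sys}

/-- The pairs `(N, ψ)` with `N(ψ) = c` form a closed subset of the compact product of free
operations and states, and this set is its projection. Closedness is tested on the functionals `tr[·
M]`, the only ones the BW topology controls. -/
theorem isCompact_converts (c : TraceClass (Q.space a)) :
    IsCompact {ψ | ψ ∈ Q.states a ∧ Q.Converts ψ c} := by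
  have : CompactSpace (Q.states a) := isCompact_iff_compactSpace.mp (Q.states_compact a)
  have : CompactSpace (Q.free a a) := isCompact_iff_compactSpace.mp (Q.free_compact a a)
  have hcl : IsClosed {p : Q.free a a × Q.states a | p.1.1 p.2.1 = c} := by
    have h : {p : Q.free a a × Q.states a | p.1.1 p.2.1 = c} =
        ⋂ M, {p : Q.free a a × Q.states a |
          opTrace ((p.1.1 p.2.1).op * M) = opTrace (c.op * M)} := by
      ext p
      simp only [Set.mem_ofPred_eq, Set.mem_iInter]
      exact ⟨fun h M => by rw [h], fun h => TraceClass.ext_opTrace h⟩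
    rw [h]
    refine isClosed_iInter fun M => isClosed_eq ?_ continuous_const
    exact (continuous_opTrace_eval (Q.states_subset a) M).comp
      (f := fun p : Q.free a a × Q.states a => (p.1.1, p.2)) (by fun_prop)
  have himg := hcl.isCompact.image (f := fun p : Q.free a a × Q.states a => p.2.1) (by fun_prop)
  convert himg using 1
  ext ψ
  constructor
  · rintro ⟨hψ, N, hN, h⟩
    exact ⟨(⟨N, hN⟩, ⟨ψ, hψ⟩), h, rfl⟩
  · rintro ⟨p, h, rfl⟩
    exact ⟨p.2.2, p.1.1, p.1.2, h⟩

theorem converts_refl (φ : TraceClass (Q.space a)) : Q.Converts φ φ :=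
  ⟨_, Q.free_id a, rfl⟩

theorem Converts.trans {Q : QRT.{u, v}} {a : Q.Sys} {φ ψ χ : TraceClass (Q.space a)}
    (h : Q.Converts φ ψ) (h' : Q.Converts ψ χ) : Q.Converts φ χ := by
  obtain ⟨N, hN, rfl⟩ := h
  obtain ⟨M, hM, rfl⟩ := h'
  exact ⟨_, Q.free_comp M hM N hN, rfl⟩

/-- Every state lies below a maximally resourceful one. -/
theorem exists_maximal_converts {φ : TraceClass (Q.space a)} (hφ : φ ∈ Q.states a) :
    ∃ m ∈ Q.maximal a, Q.Converts m φ := by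
  let X := {ψ : TraceClass (Q.space a) // ψ ∈ Q.states a ∧ Q.Converts ψ φ}
  -- Zorn's lemma on the states above `φ`. Along a chain the sets of states above its members are
  -- nonempty, compact and directed, so a common point bounds the chain; the empty chain is bounded
  -- by `φ`.
  obtain ⟨m, hm⟩ := exists_maximal_of_chains_bounded (α := X) (r := fun x y => Q.Converts y.1 x.1)
    (fun c hc => by
      have : Std.Refl fun x y : X => Q.Converts y.1 x.1 := ⟨fun x => Q.converts_refl x.1⟩
      rcases c.eq_empty_or_nonempty with rfl | hne
      · exact ⟨⟨φ, hφ, Q.converts_refl φ⟩, by simp⟩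
      · have : Nonempty c := hne.to_subtype
        obtain ⟨ψ, hψ⟩ := IsCompact.nonempty_iInter_of_directed_nonempty_isCompact_isClosed
          (fun x : c => {ψ | ψ ∈ Q.states a ∧ Q.Converts ψ x.1.1})
          (fun x y => by
            rcases hc.total (r := fun x y : X => Q.Converts y.1 x.1) x.2 y.2 with h | h
            · exact ⟨y, fun ψ hψ => ⟨hψ.1, hψ.2.trans h⟩, le_rfl⟩
            · exact ⟨x, le_rfl, fun ψ hψ => ⟨hψ.1, hψ.2.trans h⟩⟩)
          (fun x => ⟨x.1.1, x.1.2.1, Q.converts_refl _⟩)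
          (fun x => Q.isCompact_converts _) (fun x => (Q.isCompact_converts _).isClosed)
        rw [Set.mem_iInter] at hψ
        obtain ⟨x⟩ := this
        exact ⟨⟨ψ, (hψ x).1, (hψ x).2.trans x.1.2.2⟩, fun y hy => (hψ ⟨y, hy⟩).2⟩)
    (fun h h' => h'.trans h)
  -- A state above `m` is also above `φ`, so maximality within `X` is maximality among all states.
  exact ⟨m.1, ⟨m.2.1, fun ψ hψ h => hm ⟨ψ, hψ, h.trans m.2.2⟩ h⟩, m.2.2⟩

/-! ### Bounds on the measure and on conversion rates -/

section Measure

variable {Q} {Rmax : Q.Sys → ℝ≥0} {R : ∀ a : Q.Sys, Q.states a → ℝ}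

theorem measure_unit (hnorm : Q.IsConventionallyNormalized Rmax R)
    (h : Q.unitState ∈ Q.states Q.unit) : R Q.unit ⟨Q.unitState, h⟩ = 0 :=
  (hnorm Q.unit ⟨Q.unitState, h⟩).1
    ⟨h, fun b _ hφ => ⟨_, Q.traceChannel_free b, Q.traceChannel_apply hφ⟩⟩

/-- The trace is a free operation onto the unit state, which is free and so has measure zero. -/
theorem measure_nonneg (hR : Q.IsResourceMeasure R)
    (hnorm : Q.IsConventionallyNormalized Rmax R) (ρ : Q.states a) : 0 ≤ R a ρ := by
  rw [← measure_unit hnorm (Q.unitState_mem ρ.2)]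
  exact hR _ _ ρ _ _ (Q.traceChannel_free a) (Q.traceChannel_apply ρ.2)

theorem measure_le_max (hR : Q.IsResourceMeasure R)
    (hnorm : Q.IsConventionallyNormalized Rmax R) (ρ : Q.states a) : R a ρ ≤ Rmax a := by
  obtain ⟨m, hm, N, hN, h⟩ := Q.exists_maximal_converts ρ.2
  rw [← (hnorm a ⟨m, hm.1⟩).2 hm]
  exact hR _ _ _ _ N hN h

/-- Near `φ^{⊗ n}` the measure is at least `n c` if it is at least `c` near `φ`. -/
theorem mul_le_measure_of_norm_sub_spow_lt (hR : Q.IsResourceMeasure R)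
    (hnorm : Q.IsConventionallyNormalized Rmax R) (hsuper : Q.IsStronglySuperadditive R)
    {φ : TraceClass (Q.space a)} (hφ : φ ∈ Q.states a) {ε c : ℝ}
    (hε : ∀ σ : Q.states a, ‖(σ : TraceClass (Q.space a)) - φ‖ < ε → c ≤ R a σ) (n : ℕ) :
    ∀ ρ : Q.states (Q.tpow a n), ‖(ρ : TraceClass (Q.space (Q.tpow a n))) - Q.spow φ n‖ < ε →
      n * c ≤ R (Q.tpow a n) ρ := by
  induction n with
  | zero =>
    intro ρ _
    simpa using measure_nonneg hR hnorm ρ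
  | succ n ih =>
    intro ρ hρ
    have h1 : (Q.ampLeft (Q.tpow a n) a).channel (Q.spow φ (n + 1)) = Q.spow φ n := by
      refine (Q.ptrace_ampLeft_tens _ _).trans ?_
      rw [(Q.states_subset a hφ).2, one_smul]
    have h2 : (Q.ampRight (Q.tpow a n) a).channel (Q.spow φ (n + 1)) = φ := by
      refine (Q.ptrace_ampRight_tens _ _).trans ?_
      rw [(Q.states_subset _ (Q.spow_mem hφ n)).2, one_smul]
    -- The same `ε` serves every `n`: both partial traces contract the distance, and they send
    -- `φ^{⊗(n+1)}` to `φ^{⊗n}` and `φ`.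
    have h3 := ih ⟨_, Q.ptrace_left_mem ρ.1 ρ.2⟩ (by
      refine lt_of_le_of_lt ?_ hρ
      rw [← h1]
      refine le_trans (le_of_eq ?_) ((Q.ampLeft (Q.tpow a n) a).norm_ptrace_le _)
      exact congrArg norm (map_sub (Q.ampLeft (Q.tpow a n) a).channel.toLin _ _).symm)
    have h4 := hε ⟨_, Q.ptrace_right_mem ρ.1 ρ.2⟩ (by
      refine lt_of_le_of_lt ?_ hρ
      refine le_trans (le_of_eq ?_) ((Q.ampRight (Q.tpow a n) a).norm_ptrace_le _)
      conv_lhs => rw [← h2]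
      exact congrArg norm (map_sub (Q.ampRight (Q.tpow a n) a).channel.toLin _ _).symm)
    have h5 := hsuper _ _ ρ ⟨_, Q.ptrace_left_mem ρ.1 ρ.2⟩ ⟨_, Q.ptrace_right_mem ρ.1 ρ.2⟩
      (Q.isReduction_ptrace ρ.1)
    push_cast
    change _ ≤ R (Q.tensor (Q.tpow a n) a) ρ
    linarith

/-- An achievable rate `r` of conversion from `φ` to `ψ` satisfies `r R(ψ) ≤ R(φ)`. -/
theorem rate_mul_measure_le (hR : Q.IsResourceMeasure R)
    (hnorm : Q.IsConventionallyNormalized Rmax R) (hadd : Q.IsWeaklyAdditive R)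
    (hsuper : Q.IsStronglySuperadditive R) (hlsc : ∀ a : Q.Sys, LowerSemicontinuous (R a))
    (φ : Q.states a) (ψ : Q.states b) {r : ℝ≥0} (hr : r ∈ Q.rates φ.1 ψ.1) :
    r * R b ψ ≤ R a φ := by
  obtain ⟨N, hN, hlim⟩ := hr
  have key : ∀ c < R b ψ, r * c ≤ R a φ := by
    intro c hc
    -- Positivity of `c` is needed below to replace `r n` by its ceiling.
    rcases le_or_gt c 0 with hc0 | hc0
    · exact (mul_nonpos_of_nonneg_of_nonpos r.2 hc0).trans (measure_nonneg hR hnorm φ)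
    obtain ⟨ε, hε, hball⟩ := Metric.eventually_nhds_iff.mp (hlsc b ψ c hc)
    have hfreq := Filter.frequently_lt_of_liminf_lt (by isBoundedDefault)
      (hlim.trans_lt (ENNReal.ofReal_pos.mpr hε))
    -- `n ≥ 1` is required both by weak additivity and for dividing by `n`.
    obtain ⟨n, hn, hn1⟩ := (hfreq.and_eventually (Filter.eventually_ge_atTop 1)).exists
    have hdist : ‖N n (Q.spow φ.1 n) - Q.spow ψ.1 ⌈r * n⌉₊‖ < ε := by
      rwa [← ofReal_norm, ENNReal.ofReal_lt_ofReal_iff hε] at hn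
    have h1 := mul_le_measure_of_norm_sub_spow_lt hR hnorm hsuper ψ.2 (c := c)
      (fun σ hσ => (hball (by rwa [Subtype.dist_eq, dist_eq_norm])).le) _
      ⟨_, Q.free_map _ (hN n) _ (Q.spow_mem φ.2 n)⟩ hdist
    have h2 := hR _ _ ⟨_, Q.spow_mem φ.2 n⟩ ⟨_, Q.free_map _ (hN n) _ (Q.spow_mem φ.2 n)⟩ _
      (hN n) rfl
    rw [hadd a φ n ⟨_, Q.spow_mem φ.2 n⟩ hn1 rfl] at h2
    have h3 : (r : ℝ) * n ≤ ⌈r * n⌉₊ := by exact_mod_cast Nat.le_ceil (r * n)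
    have hn0 : (0 : ℝ) < n := by exact_mod_cast hn1
    refine le_of_mul_le_mul_left ?_ hn0
    calc (n : ℝ) * (r * c) = (r * n) * c := by ring
      _ ≤ ⌈r * n⌉₊ * c := by gcongr
      _ ≤ n * R a φ := h1.trans h2
  rcases eq_or_lt_of_le r.2 with h0 | hpos
  · have : (r : ℝ) = 0 := h0.symm
    rw [this, zero_mul]
    exact measure_nonneg hR hnorm φ
  · have hpos' : (0 : ℝ) < r := hpos
    rw [← le_div_iff₀' hpos']
    exact le_of_forall_lt_imp_le_of_dense fun c hc => (le_div_iff₀' hpos').mpr (key c hc)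

theorem rconv_mul_measure_le (hR : Q.IsResourceMeasure R)
    (hnorm : Q.IsConventionallyNormalized Rmax R) (hadd : Q.IsWeaklyAdditive R)
    (hsuper : Q.IsStronglySuperadditive R) (hlsc : ∀ a : Q.Sys, LowerSemicontinuous (R a))
    (φ : Q.states a) (ψ : Q.states b) :
    Q.rconv φ.1 ψ.1 * ENNReal.ofReal (R b ψ) ≤ ENNReal.ofReal (R a φ) := by
  simp only [rconv, ENNReal.iSup_mul]
  refine iSup₂_le fun r hr => ?_
  rw [← ENNReal.ofReal_coe_nnreal, ← ENNReal.ofReal_mul r.coe_nonneg]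
  exact ENNReal.ofReal_le_ofReal (rate_mul_measure_le hR hnorm hadd hsuper hlsc φ ψ hr)

end Measure

end QRT

end QResource

end

/-! ### The two bounds -/

theorem mainTheorem12 (Q : QResource.QRT.{u, v}) (Rmax : Q.Sys → ℝ≥0)
    (R : ∀ a : Q.Sys, Q.states a → ℝ)
    (hR : Q.IsResourceMeasure R)
    (hnorm : Q.IsConventionallyNormalized Rmax R)
    (hadd : Q.IsWeaklyAdditive R)
    (hsuper : Q.IsStronglySuperadditive R)
    (hlsc : ∀ a : Q.Sys, LowerSemicontinuous (R a))
    (H : Q.Sys)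
    (hcat : ∀ φ : QResource.TraceClass (Q.space H), ¬ Q.IsCatalyticallyReplicable φ)
    (ψ : Q.states H) :
    ((Q.distillable Rmax (ψ : QResource.TraceClass (Q.space H)) : ℝ≥0∞) : EReal) ≤
        ((R H ψ : ℝ) : EReal) ∧
      ((R H ψ : ℝ) : EReal) ≤
        ((Q.cost Rmax (ψ : QResource.TraceClass (Q.space H)) : ℝ≥0∞) : EReal) := by
  have h0 := QResource.QRT.measure_nonneg hR hnorm ψ
  have hE : ((R H ψ : ℝ) : EReal) = (ENNReal.ofReal (R H ψ) : ℝ≥0∞) := by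
    rw [EReal.coe_ennreal_ofReal, max_eq_left h0]
  rw [hE, EReal.coe_ennreal_le_coe_ennreal_iff, EReal.coe_ennreal_le_coe_ennreal_iff]
  constructor
  -- The infimum is bounded by its value at a maximally resourceful target, where the measure equals
  -- `Rmax H`.
  · obtain ⟨m, hm, -⟩ := Q.exists_maximal_converts ψ.2
    refine (iInf₂_le m hm.1).trans ?_
    have h := QResource.QRT.rconv_mul_measure_le hR hnorm hadd hsuper hlsc ψ ⟨m, hm.1⟩
    rwa [(hnorm H ⟨m, hm.1⟩).2 hm, ENNReal.ofReal_coe_nnreal] at h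
  · refine le_iInf₂ fun φ hφ => ?_
    have h := QResource.QRT.rconv_mul_measure_le hR hnorm hadd hsuper hlsc ⟨φ, hφ⟩ ψ
    have hmax : ∀ ρ : Q.states H, ENNReal.ofReal (R H ρ) ≤ Rmax H := fun ρ => by
      rw [← ENNReal.ofReal_coe_nnreal]
      exact ENNReal.ofReal_le_ofReal (QResource.QRT.measure_le_max hR hnorm ρ)
    -- If `Rmax H = 0`, the measure vanishes and the bound is trivial. Otherwise the numerator is
    -- nonzero and finite, so the division can be cleared even when the rate is `0` or `∞`.
    rcases eq_or_ne (Rmax H) 0 with hz | hz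
    · have := hmax ψ
      rw [hz, ENNReal.coe_zero, nonpos_iff_eq_zero] at this
      rw [this]
      exact zero_le
    · rw [ENNReal.le_div_iff_mul_le (Or.inr (by simpa using hz)) (Or.inr ENNReal.coe_ne_top),
        mul_comm]
      exact h.trans (hmax _)
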